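/- Let $k$ be a perfect field of characteristic $p>0$, let $M\cong\mathbb Z^n$ be a lattice, $M_{\mathbb R}=M\otimes\mathbb R$, and let $S\subset M$ be a finitely generated submonoid with $\mathbb ZS=M$ whose cone $C=\mathbb R_+S\subset M_{\mathbb R}$ is pointed. For a face $D$ of $C$ let $\langle D\rangle$ be its linear span and $M_D=\mathbb Z(S\cap D)$. Assume that $S$ is seminormal, i.e. $S\cap\mathrm{int}(D)=M_D\cap\mathrm{int}(D)$ for every face $D$ of $C$, where $\mathrm{int}$ denotes the relative interior. A face $D$ of $C$ is called an RUF (relatively unsaturated face) if $D=C$, or if $D\subsetneq C$ and $M_D\neq\bigcap_{D'\supsetneq D}M_{D'}\cap\langle D\rangle$, the intersection being over all faces $D'$ of $C$ strictly containing $D$. Let $D_S=\bigcap_{D\ \mathrm{RUF}}D$, and let \[P_{\overline S}=\{x\in M_{\mathbb R}\mid 0\le\langle x,v_\rho\rangle<1\text{ for all }\rho\},\qquad P_S=P_{\overline S}\cap D_S,\] where $\rho$ runs over the extremal rays of the dual cone of $C$ and $v_\rho\in\mathrm{Hom}(M,\mathbb Z)$ is the primitive generator of $\rho$. Let $R=k[S]$,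 let $\mathfrak m$ be the ideal of $R$ generated by the monomials $x^u$ with $u\in S\setminus\{0\}$, and for $e\ge 0$ let $F^e_*R$ be the $R$-module $R$ on which $r$ acts by multiplication with $r^{p^e}$. Assume that $R$ is F-split, i.e. there is an $R$-linear map $\pi\colon F_*R\to R$ with $\pi\circ F=\mathrm{id}_R$. Let $a_e(R)$ (the $e$-th F-splitting number) be the maximal rank of a free direct summand of $F^e_*R$. Then: 1. For every $e\ge 0$ the set $\frac1{p^e}S\cap P_S$ is finite and \[a_e(R)=\#\Bigl(\tfrac1{p^e}S\cap P_S\Bigr).\] 2. The F-splitting dimension of $R$ is $\delta=\dim D_S$ and the F-splitting ratio of $R$ is the lattice volume of $P_S$ with respect to $M_{D_S}$ (the volume on $\langle D_S\rangle$ for which a fundamental parallelotope of $M_{D_S}$ has volume $1$); that is, \[\lim_{e\to\infty}\frac{a_e(R)}{p^{e\dim D_S}}=\mathrm{Vol}_{M_{D_S}}(P_S),\qquad 0<\mathrm{Vol}_{M_{D_S}}(P_S)<\infty.\] 3. The F-splitting prime of $R$, i.e. the ideal generated by all $f\in R$ such that $\varphi(F^e_*f)\in\mathfrak m$ for all $e>0$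 and all $\varphi\in\mathrm{Hom}_R(F^e_*R,R)$, is the ideal generated by the monomials $x^u$ with $u\in S$, $u\notin D_S$. -/

import Mathlib

open Module Filter Topology MeasureTheory
open scoped ENNReal

noncomputable section

/-! ### Frobenius push-forwards, F-splittings and their numerical invariants -/

/-- The `R`-module `F^e_* R`: the additive group of `R`, on which `r : R` acts as
multiplication by `r ^ (p ^ e)`. -/
def FrobPush (R : Type*) (_p _e : ℕ) : Type _ := R

namespace FrobPush

variable (R : Type*) [CommRing R] (p e : ℕ)

instance : AddCommGroup (FrobPush R p e) := inferInstanceAs (AddCommGroup R)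

instance [ExpChar R p] : Module R (FrobPush R p e) :=
  letI : Module R (FrobPush R p e) := inferInstanceAs (Module R R)
  Module.compHom (FrobPush R p e) (iterateFrobenius R p e)

/-- The element `F^e_* r` of `F^e_* R`. -/
def of : R ≃+ FrobPush R p e := AddEquiv.refl R

/-- The module structure is the expected one: `r • F^e_* x = F^e_* (r ^ (p ^ e) * x)`. -/
theorem smul_of [ExpChar R p] (r x : R) : r • of R p e x = of R p e (r ^ p ^ e * x) := rfl

end FrobPush

section Invariants

variable (R : Type*) [CommRing R] (p : ℕ) [ExpChar R p]

/-- `R` is F-split: there is an `R`-linear map `π : F_* R → R` with `π ∘ F = id`. -/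
def IsFSplit : Prop :=
  ∃ π : FrobPush R p 1 →ₗ[R] R, ∀ r : R, π (FrobPush.of R p 1 (frobenius R p r)) = r

/-- `F^e_* R` has a free direct summand of rank `n` (a split copy of `R ^ n`). -/
def HasFreeSummand (e n : ℕ) : Prop :=
  ∃ (i : (Fin n → R) →ₗ[R] FrobPush R p e) (π : FrobPush R p e →ₗ[R] (Fin n → R)),
    π ∘ₗ i = LinearMap.id

/-- The `e`-th F-splitting number `a_e(R)`, the maximal rank of a free direct summand of
`F^e_* R` (with the value `⊤` if the ranks are unbounded). -/
def fSplittingNumber (e : ℕ) : ℕ∞ :=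
  ⨆ (n : ℕ) (_ : HasFreeSummand R p e n), (n : ℕ∞)

/-- `δ` is the F-splitting dimension and `r` is the F-splitting ratio of `R`:
`a_e(R) / p ^ (e δ)` tends to `r` as `e → ∞`, and `0 < r < ∞`.
(There is at most one such pair `(δ, r)`.) -/
def HasFSplittingDimRatio (δ : ℕ) (r : ℝ≥0∞) : Prop :=
  0 < r ∧ r < ⊤ ∧
    Tendsto (fun e : ℕ => (fSplittingNumber R p e : ℝ≥0∞) / (p : ℝ≥0∞) ^ (e * δ)) atTop (𝓝 r)

/-- The F-splitting prime of `R` with respect to the (homogeneous) maximal ideal `𝔪`: the ideal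
generated by the `f` with `φ (F^e_* f) ∈ 𝔪` for all `e > 0` and all `φ ∈ Hom_R(F^e_* R, R)`. -/
def fSplittingPrime (𝔪 : Ideal R) : Ideal R :=
  Ideal.span {f | ∀ e : ℕ, 0 < e → ∀ φ : FrobPush R p e →ₗ[R] R, φ (FrobPush.of R p e f) ∈ 𝔪}

end Invariants

/-! ### Monoid algebras -/

instance AddMonoidAlgebra.charP_of_field (k A : Type*) [Field k] [AddCommMonoid A] (p : ℕ)
    [CharP k p] : CharP (AddMonoidAlgebra k A) p :=
  charP_of_injective_algebraMap (algebraMap k (AddMonoidAlgebra k A)).injective p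

/-- The ideal of `k[A]` generated by the monomials `x ^ u` with `u ∈ T`. -/
def monomialIdeal (k : Type*) {A : Type*} [Field k] [AddCommMonoid A] (T : Set A) :
    Ideal (AddMonoidAlgebra k A) :=
  Ideal.span ((fun u => AddMonoidAlgebra.single u (1 : k)) '' T)

/-! ### Seminormal monoids, faces, relatively unsaturated faces

The lattice `M` sits in the real vector space `V = M_ℝ`, and `S` is a submonoid of `V`
with `ℤ S = M`. -/

section Monoid

variable {V : Type*} [NormedAddCommGroup V] [NormedSpace ℝ V]

/-- The cone `C(S) = ℝ_+ S`. -/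
def monoidCone (S : AddSubmonoid V) : PointedCone ℝ V := PointedCone.hull ℝ (S : Set V)

/-- The lattice `M_D = ℤ (S ∩ D)` of a face `D`. -/
def faceLattice (S : AddSubmonoid V) (D : PointedCone ℝ V) : Submodule ℤ V :=
  Submodule.span ℤ ((S : Set V) ∩ (D : Set V))

/-- `S` is seminormal: `S ∩ int D = M_D ∩ int D` for all faces `D` of `C(S)`,
where `int` is the relative interior. -/
def IsSeminormalMonoid (S : AddSubmonoid V) : Prop :=
  ∀ D : PointedCone ℝ V, D.IsFaceOf (monoidCone S) →
    (S : Set V) ∩ intrinsicInterior ℝ (D : Set V) =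
      (faceLattice S D : Set V) ∩ intrinsicInterior ℝ (D : Set V)

/-- The condition `M_D = ⋂_{D' ⊋ D} M_{D'} ∩ ⟨D⟩` (for a proper face `D`), where `D'` runs over the
faces of `C(S)` strictly containing `D` and `⟨D⟩` is the linear span of `D`. -/
def IsRelSaturated (S : AddSubmonoid V) (D : PointedCone ℝ V) : Prop :=
  faceLattice S D =
    (⨅ D' ∈ {D' : PointedCone ℝ V | D'.IsFaceOf (monoidCone S) ∧ D < D'}, faceLattice S D') ⊓
      (Submodule.span ℝ (D : Set V)).restrictScalars ℤ

/-- Relatively unsaturated faces (RUFs): `C(S)` itself, and the proper faces that are not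
relatively saturated. -/
def IsRUF (S : AddSubmonoid V) (D : PointedCone ℝ V) : Prop :=
  D.IsFaceOf (monoidCone S) ∧ (D = monoidCone S ∨ ¬ IsRelSaturated S D)

/-- `D_S`, the intersection of all RUFs of `S`. -/
def rufIntersection (S : AddSubmonoid V) : PointedCone ℝ V :=
  sInf {D | IsRUF S D}

/-- The functional `v` takes integer values on `M`, i.e. it lies in the dual lattice `Hom(M, ℤ)`. -/
def IsIntegralOn (M : Submodule ℤ V) (v : Dual ℝ V) : Prop :=
  ∀ m ∈ M, ∃ z : ℤ, v m = z

/-- `v` is the primitive generator `v_ρ` of an extremal ray `ρ` of the dual cone of `C`: it is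
nonzero, `ρ = ℝ_+ v` is a face of the dual cone, `v` lies in the dual lattice of `M`,
and `v` is not a proper multiple of an element of the dual lattice. -/
def IsPrimitiveRayGenerator (M : Submodule ℤ V) (C : PointedCone ℝ V) (v : Dual ℝ V) : Prop :=
  v ≠ 0 ∧
  (PointedCone.hull ℝ {v}).IsFaceOf (PointedCone.dual (Dual.eval ℝ V) (C : Set V)) ∧
  IsIntegralOn M v ∧
  ∀ (w : Dual ℝ V) (n : ℕ), IsIntegralOn M w → v = n • w → n = 1

/-- The polytope `{x ∈ M_ℝ | 0 ≤ ⟨x, v_ρ⟩ < 1 for all ρ}` attached to the saturation of `S`. -/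
def saturationPolytope (M : Submodule ℤ V) (S : AddSubmonoid V) : Set V :=
  {x | ∀ v : Dual ℝ V, IsPrimitiveRayGenerator M (monoidCone S) v → 0 ≤ v x ∧ v x < 1}

/-- The polytope `P_S`, the intersection of the polytope of the saturation with `D_S`. -/
def splittingPolytope (M : Submodule ℤ V) (S : AddSubmonoid V) : Set V :=
  saturationPolytope M S ∩ (rufIntersection S : Set V)

/-- The set `(1/q) S`. -/
def fractionalPoints (S : AddSubmonoid V) (q : ℕ) : Set V := {x | q • x ∈ S}

open Classical in
/-- The volume of `P ⊆ ⟨L⟩` with respect to a lattice `L` of finite rank `d`, normalized so that a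
fundamental parallelotope of `L` has volume `1`: it is the Lebesgue measure in `ℝ ^ d` of `P` in the
coordinates of a `ℤ`-basis of `L`. The choice of the basis does not matter, since two bases differ
by an integer matrix of determinant `±1`. (The value is `0` if `L` has no finite basis.) -/
def latticeVolume (L : Submodule ℤ V) (P : Set V) : ℝ≥0∞ :=
  if h : Nonempty (Basis (Fin (finrank ℤ L)) ℤ L) then
    volume {c : Fin (finrank ℤ L) → ℝ | ∑ i, c i • (h.some i : V) ∈ P}
  else 0

end Monoid

end

/-! Everything reduces to one combinatorial condition. Write q = p^e. An element s of S is split if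
s + q m ∈ S with m ∈ M forces m ∈ S; the point u = s/q is then a split point.

Algebra. If some φ sends F^e_* of a multiple of x^s to an element with nonzero constant coefficient,
comparing coefficients shows that s is split (`isSplitElement_of_coeff_zero_ne_zero`). Conversely,
for split s, taking q-th roots of the monomials x^(s + q w) and killing all others is a linear map
sending x^s to 1 (`monomialRootHom`); this uses perfectness of k. Hence constant coefficients of
φ(F^e_* f) see only the split part of f. So a_e is the number of split elements
(`fSplittingNumber_eq_encard`), and the splitting prime is spanned by the monomials that are split
for no e > 0 (`fSplittingPrime_eq_monomialIdeal`).

Combinatorics. The split points are exactly the points of (1/q)S in P_S (`isSplitPoint_iff`).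
F-splitness enters only through `mem_of_isFSplit`: x ∈ M and q x ∈ S imply x ∈ S, so (M ∩ ⟨D⟩)/M_D
has no p-torsion for every face D. If u is split but misses an RUF D, an element witnessing that D
is unsaturated contradicts splitness; if ⟨u, v_ρ⟩ ≥ 1, some m with ⟨m, v_ρ⟩ = -1 does. Conversely,
for u in P_S and q(u + m) ∈ S, integrality gives m ∈ C, and a maximal face D with m ∈ D but m ∉ M_D
would be an RUF, hence would contain u, which makes m a p-power torsion class modulo M_D.

Asymptotics. In coordinates of a basis of M_{D_S}, P_S is a bounded convex set with nonempty
interior. By seminormality the count lies between the numbers of grid points in its interior and in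
its closure, and the frontier of a convex set is null. -/

/-! ### Faces, relative interiors and Farkas' lemma for pointed cones -/

namespace PointedCone

variable {V : Type*} [AddCommGroup V] [Module ℝ V]

/-- The smallest face of `C` containing the point `x` of `C`. -/
def minFace (C : PointedCone ℝ V) (x : V) (hx : x ∈ C) : PointedCone ℝ V where
  carrier := {y | y ∈ C ∧ ∃ ε : ℝ, 0 < ε ∧ x - ε • y ∈ C}
  zero_mem' := ⟨C.zero_mem, 1, one_pos, by simpa using hx⟩
  add_mem' := by
    rintro y z ⟨hy, ε, hε, hyε⟩ ⟨hz, δ, hδ, hzδ⟩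
    refine ⟨C.add_mem hy hz, min ε δ / 2, by positivity, ?_⟩
    have h := C.add_mem (C.smul_mem (by norm_num : (0 : ℝ) ≤ 1 / 2) hyε)
      (C.smul_mem (by norm_num : (0 : ℝ) ≤ 1 / 2) hzδ)
    have h₁ := C.smul_mem (by linarith [min_le_left ε δ] : 0 ≤ ε / 2 - min ε δ / 2) hy
    have h₂ := C.smul_mem (by linarith [min_le_right ε δ] : 0 ≤ δ / 2 - min ε δ / 2) hz
    convert C.add_mem h (C.add_mem h₁ h₂) using 1
    module
  smul_mem' := by
    rintro ⟨c, hc⟩ y ⟨hy, ε, hε, hyε⟩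
    refine ⟨C.smul_mem hc hy, ε / (c + 1), by positivity, ?_⟩
    have h₁ : 0 ≤ ε - ε / (c + 1) * c := by
      rw [div_mul_eq_mul_div, sub_nonneg, div_le_iff₀ (by positivity)]
      nlinarith
    convert C.add_mem hyε (C.smul_mem h₁ hy) using 1
    change x - (ε / (c + 1)) • c • y = _
    module

variable {C D D' : PointedCone ℝ V} {x y s : V}

theorem minFace_isFaceOf (hx : x ∈ C) : (C.minFace x hx).IsFaceOf C := by
  refine .of_mem_of_add_mem_left (fun y hy ↦ hy.1) fun {y z} hy hz h ↦ ?_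
  obtain ⟨-, ε, hε, h⟩ := h
  refine ⟨hy, ε, hε, ?_⟩
  convert C.add_mem h (C.smul_mem hε.le hz) using 1
  module

theorem self_mem_minFace (hx : x ∈ C) : x ∈ C.minFace x hx :=
  ⟨hx, 1, one_pos, by simp⟩

/-- The points of the algebraic relative interior of a pointed cone. -/
def IsRelInterior (D : PointedCone ℝ V) (x : V) : Prop :=
  x ∈ D ∧ ∀ y ∈ D, ∃ ε : ℝ, 0 < ε ∧ x - ε • y ∈ D

theorem isRelInterior_minFace (hx : x ∈ C) : (C.minFace x hx).IsRelInterior x := by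
  refine ⟨self_mem_minFace hx, ?_⟩
  rintro y ⟨hy, ε, hε, h⟩
  refine ⟨ε, hε, h, 1, one_pos, ?_⟩
  convert C.smul_mem hε.le hy using 1
  module

/-- Testing generators suffices, because the vectors of which a positive multiple can be subtracted
from `x` form a cone, namely `minFace`. -/
theorem isRelInterior_of_subset_hull {T : Set V} (hD : D ≤ hull ℝ T) (hx : x ∈ D)
    (h : ∀ g ∈ T, g ∈ D ∧ ∃ ε : ℝ, 0 < ε ∧ x - ε • g ∈ D) : D.IsRelInterior x := by
  refine ⟨hx, fun y hy ↦ ?_⟩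
  have : hull ℝ T ≤ D.minFace x hx := Submodule.span_le.2 fun g hg ↦ h g hg
  exact (this (hD hy)).2

theorem IsRelInterior.add (hx : D.IsRelInterior x) (hy : y ∈ D) : D.IsRelInterior (x + y) := by
  refine ⟨D.add_mem hx.1 hy, fun z hz ↦ ?_⟩
  obtain ⟨ε, hε, h⟩ := hx.2 z hz
  refine ⟨ε, hε, ?_⟩
  convert D.add_mem h hy using 1
  module

theorem IsRelInterior.smul (hx : D.IsRelInterior x) {c : ℝ} (hc : 0 < c) :
    D.IsRelInterior (c • x) := by
  refine ⟨D.smul_mem hc.le hx.1, fun z hz ↦ ?_⟩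
  obtain ⟨ε, hε, h⟩ := hx.2 z hz
  refine ⟨c * ε, by positivity, ?_⟩
  convert D.smul_mem hc.le h using 1
  module

theorem IsRelInterior.le_of_mem_face (hx : D.IsRelInterior x) (hD : D ≤ C)
    (hD' : D'.IsFaceOf C) (h : x ∈ D') : D ≤ D' := by
  intro y hy
  obtain ⟨ε, hε, hyε⟩ := hx.2 y hy
  exact hD'.mem_of_smul_add_mem (hD hy) (hD hyε) hε (by simpa using h)

/-- Both signs are carried along so that the induction on the span survives negative scalars. -/
theorem IsRelInterior.exists_add_smul_mem (hs : D.IsRelInterior s)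
    (hx : x ∈ Submodule.span ℝ (D : Set V)) :
    ∃ N : ℕ, x + (N : ℝ) • s ∈ D ∧ -x + (N : ℝ) • s ∈ D := by
  induction hx using Submodule.span_induction with
  | mem x hx =>
    obtain ⟨ε, hε, h⟩ := hs.2 x hx
    obtain ⟨N, hN⟩ := exists_nat_ge ε⁻¹
    refine ⟨N, D.add_mem hx (D.smul_mem N.cast_nonneg hs.1), ?_⟩
    convert D.add_mem (D.smul_mem (inv_pos.2 hε).le h) (D.smul_mem (sub_nonneg.2 hN) hs.1) using 1
    rw [smul_sub, smul_smul, inv_mul_cancel₀ hε.ne']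
    module
  | zero => exact ⟨0, by simp⟩
  | add x y _ _ hx hy =>
    obtain ⟨N, h₁, h₂⟩ := hx
    obtain ⟨N', h₃, h₄⟩ := hy
    refine ⟨N + N', ?_, ?_⟩
    · convert D.add_mem h₁ h₃ using 1; push_cast; module
    · convert D.add_mem h₂ h₄ using 1; push_cast; module
  | smul c x _ hx =>
    obtain ⟨N, h₁, h₂⟩ := hx
    obtain ⟨N', hN'⟩ := exists_nat_ge (|c| * N)
    have h := D.smul_mem (sub_nonneg.2 hN') hs.1
    refine ⟨N', ?_⟩
    rcases le_total 0 c with hc | hc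
    · rw [abs_of_nonneg hc] at h
      constructor
      · convert D.add_mem (D.smul_mem hc h₁) h using 1; module
      · convert D.add_mem (D.smul_mem hc h₂) h using 1; module
    · rw [abs_of_nonpos hc] at h
      constructor
      · convert D.add_mem (D.smul_mem (neg_nonneg.2 hc) h₂) h using 1; module
      · convert D.add_mem (D.smul_mem (neg_nonneg.2 hc) h₁) h using 1; module

theorem IsRelInterior.exists_forall_add_smul (hs : D.IsRelInterior s)
    (hx : x ∈ Submodule.span ℝ (D : Set V)) :
    ∃ N : ℕ, ∀ n : ℕ, N ≤ n → D.IsRelInterior (x + (n : ℝ) • s) := by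
  obtain ⟨N, h, -⟩ := hs.exists_add_smul_mem hx
  refine ⟨N + 1, fun n hn ↦ ?_⟩
  have hn' : (N : ℝ) + 1 ≤ n := by exact_mod_cast hn
  convert (hs.smul (by linarith : 0 < (n : ℝ) - N)).add h using 1
  module

/-- A nonnegative combination lies in a face only if every term with positive coefficient does. A
face is therefore determined by the generators it contains. -/
theorem IsFaceOf.eq_hull_inter {T : Set V} (hD : D.IsFaceOf (hull ℝ T)) :
    D = hull ℝ (T ∩ D) := by
  refine le_antisymm (fun x hx ↦ ?_) (Submodule.span_le.2 Set.inter_subset_right)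
  have key : ∀ x ∈ hull ℝ T, x ∈ D → x ∈ hull ℝ (T ∩ (D : Set V)) := by
    intro x hx
    induction hx using Submodule.span_induction with
    | mem x hx => exact fun h ↦ Submodule.subset_span ⟨hx, h⟩
    | zero => exact fun _ ↦ zero_mem _
    | add x y hx hy ihx ihy =>
      intro h
      obtain ⟨h₁, h₂⟩ := (hD.add_mem_iff_mem hx hy).1 h
      exact add_mem (ihx h₁) (ihy h₂)
    | smul c x hx ih =>
      intro h
      obtain ⟨c, hc⟩ := c
      rcases hc.eq_or_lt with rfl | hc'
      · convert zero_mem (hull ℝ (T ∩ (D : Set V))) using 1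
        exact zero_smul ℝ x
      · exact Submodule.smul_mem _ _ (ih ((D.smul_mem_iff hc').1 h))
  exact key x (hD.le hx) hx

theorem finite_faces {T : Set V} (hT : T.Finite) :
    {D : PointedCone ℝ V | D.IsFaceOf (hull ℝ T)}.Finite := by
  refine (hT.finite_subsets.image (hull ℝ)).subset fun D hD ↦ ?_
  exact ⟨T ∩ D, Set.inter_subset_left, (IsFaceOf.eq_hull_inter hD).symm⟩

/-- **Farkas' lemma** for finitely generated cones. -/
theorem exists_dual_neg_of_notMem_hull {ι : Type*} (T : Finset ι) (g : ι → V)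
    (hx : x ∉ hull ℝ (g '' T)) : ∃ f : Dual ℝ V, (∀ i ∈ T, 0 ≤ f (g i)) ∧ f x < 0 := by
  classical
  induction T using Finset.induction_on generalizing g x with
  | empty =>
    have hx : x ≠ 0 := by rintro rfl; exact hx (zero_mem _)
    obtain ⟨f, hf⟩ := not_forall.1 (mt (Module.forall_dual_apply_eq_zero_iff ℝ x).1 hx)
    refine ⟨-(f x) • f, by simp, ?_⟩
    have := mul_self_pos.2 hf
    simpa using this
  | insert i T hi ih =>
    obtain ⟨f, hf, hfx⟩ := ih (x := x) g fun h ↦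
      hx (Submodule.span_mono (Set.image_mono (by simp)) h)
    rcases le_or_gt 0 (f (g i)) with hgi | hgi
    · exact ⟨f, by simpa [hgi] using hf, hfx⟩
    -- `π` projects along `g i` onto `ker f`. For the other generators and for `x` it differs from
    -- the identity by explicit multiples of `g i` of known sign, so `π x` in the projected hull
    -- would put `x` back in the original one. A functional composed with `π` vanishes on `g i`.
    let π : V →ₗ[ℝ] V := LinearMap.id - (f.smulRight ((f (g i))⁻¹ • g i))
    have hπ (y : V) : π y = y - (f y / f (g i)) • g i := by
      simp [π, smul_smul, div_eq_mul_inv]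
    have hgi_mem : g i ∈ hull ℝ (g '' (insert i T : Finset ι)) :=
      Submodule.subset_span ⟨i, by simp, rfl⟩
    obtain ⟨f', hf', hfx'⟩ := ih (x := π x) (fun j ↦ π (g j)) fun h ↦ by
      refine hx ?_
      have h' : π x ∈ hull ℝ (g '' (insert i T : Finset ι)) := by
        refine (Submodule.span_le.2 ?_ :
          hull ℝ ((fun j ↦ π (g j)) '' (T : Set ι)) ≤ hull ℝ (g '' (insert i T : Finset ι))) h
        rintro _ ⟨j, hj, rfl⟩
        have hj' : g j ∈ hull ℝ (g '' (insert i T : Finset ι)) :=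
          Submodule.subset_span ⟨j, by simp [Finset.mem_coe.1 hj], rfl⟩
        have := PointedCone.smul_mem _
          (neg_nonneg.2 (div_nonpos_of_nonneg_of_nonpos (hf j hj) hgi.le)) hgi_mem
        simp only [hπ, SetLike.mem_coe]
        convert add_mem hj' this using 1
        module
      have := PointedCone.smul_mem _ (div_pos_of_neg_of_neg hfx hgi).le hgi_mem
      convert add_mem h' this using 1
      rw [hπ]; module
    refine ⟨f'.comp π, ?_, hfx'⟩
    intro j hj
    rcases Finset.mem_insert.1 hj with rfl | hj
    · simp [hπ, hgi.ne]
    · exact hf' j hj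

end PointedCone

/-- From algebraic to topological: if `s` is a topological interior point and `x - ε • s ∈ D`, then
z = (x - ε s) + ε (s + ε⁻¹ (z - x)), so a neighbourhood of `s` in the affine span yields one of `x`.
-/
theorem PointedCone.mem_intrinsicInterior {V : Type*} [NormedAddCommGroup V] [NormedSpace ℝ V]
    [FiniteDimensional ℝ V] {D : PointedCone ℝ V} {x : V} :
    x ∈ intrinsicInterior ℝ (D : Set V) ↔ D.IsRelInterior x := by
  have key (z : V) : z ∈ intrinsicInterior ℝ (D : Set V) ↔
      z ∈ D ∧ (D : Set V) ∈ 𝓝[(affineSpan ℝ (D : Set V) : Set V)] z := by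
    rw [_root_.mem_intrinsicInterior]
    constructor
    · rintro ⟨y, hy, rfl⟩
      refine ⟨interior_subset (s := ((↑) ⁻¹' (D : Set V) : Set (affineSpan ℝ (D : Set V)))) hy, ?_⟩
      exact preimage_coe_mem_nhds_subtype.1 (mem_interior_iff_mem_nhds.1 hy)
    · rintro ⟨hz, h⟩
      exact ⟨⟨z, subset_affineSpan ℝ _ hz⟩,
        mem_interior_iff_mem_nhds.2 (preimage_coe_mem_nhds_subtype.2 h), rfl⟩
  constructor
  · intro h
    obtain ⟨hx, h⟩ := (key x).1 h
    refine ⟨hx, fun y hy ↦ ?_⟩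
    have ht : Tendsto (fun ε : ℝ ↦ x - ε • y) (𝓝[>] 0)
        (𝓝[(affineSpan ℝ (D : Set V) : Set V)] x) := by
      refine tendsto_nhdsWithin_iff.2 ⟨tendsto_nhdsWithin_of_tendsto_nhds ?_, .of_forall fun ε ↦ ?_⟩
      · have : Continuous fun ε : ℝ ↦ x - ε • y := by fun_prop
        simpa using this.tendsto 0
      · have := AffineSubspace.smul_vsub_vadd_mem (affineSpan ℝ (D : Set V)) ε
          (subset_affineSpan ℝ _ D.zero_mem) (subset_affineSpan ℝ _ hy)
          (subset_affineSpan ℝ _ hx)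
        rw [SetLike.mem_coe]
        convert this using 1
        simp only [vsub_eq_sub, vadd_eq_add]
        module
    obtain ⟨ε, hε, h'⟩ := ((ht.eventually_mem h).and self_mem_nhdsWithin).exists
    exact ⟨ε, h', hε⟩
  · intro hx
    obtain ⟨s, hs⟩ := Set.Nonempty.intrinsicInterior D.convex ⟨0, D.zero_mem⟩
    obtain ⟨hsD, hs⟩ := (key s).1 hs
    obtain ⟨ε, hε, hxs⟩ := hx.2 s hsD
    refine (key x).2 ⟨hx.1, ?_⟩
    have ht : Tendsto (fun z : V ↦ s + ε⁻¹ • (z - x)) (𝓝[(affineSpan ℝ (D : Set V) : Set V)] x)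
        (𝓝[(affineSpan ℝ (D : Set V) : Set V)] s) := by
      refine tendsto_nhdsWithin_iff.2 ⟨tendsto_nhdsWithin_of_tendsto_nhds ?_, ?_⟩
      · have : Continuous fun z : V ↦ s + ε⁻¹ • (z - x) := by fun_prop
        simpa using this.tendsto x
      · filter_upwards [self_mem_nhdsWithin] with z hz
        have := AffineSubspace.smul_vsub_vadd_mem (affineSpan ℝ (D : Set V)) ε⁻¹
          hz (subset_affineSpan ℝ _ hx.1) (subset_affineSpan ℝ _ hsD)
        rw [SetLike.mem_coe]
        convert this using 1
        simp only [vsub_eq_sub, vadd_eq_add]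
        module
    filter_upwards [ht hs] with z hz
    rw [SetLike.mem_coe]
    convert D.add_mem hxs (D.smul_mem hε.le hz) using 1
    rw [smul_add, smul_smul, mul_inv_cancel₀ hε.ne']
    module

/-! ### Integral functionals on a lattice -/

section Lattice

variable {V : Type*} [NormedAddCommGroup V] [NormedSpace ℝ V]

/-- The values of `h` on `M` form a nonzero subgroup of ℤ, and `d` is its positive generator. -/
theorem IsIntegralOn.exists_generator {M : Submodule ℤ V} {h : Dual ℝ V} (hh : IsIntegralOn M h)
    {m₀ : V} (hm₀ : m₀ ∈ M) (h₀ : h m₀ ≠ 0) :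
    ∃ d : ℕ, 0 < d ∧ (∀ m ∈ M, ∃ z : ℤ, h m = d * z) ∧ ∃ m ∈ M, h m = d := by
  let I : AddSubgroup ℤ :=
    { carrier := {z | ∃ m ∈ M, h m = z}
      zero_mem' := ⟨0, M.zero_mem, by simp⟩
      add_mem' := by
        rintro a b ⟨m, hm, ha⟩ ⟨m', hm', hb⟩
        exact ⟨m + m', M.add_mem hm hm', by simp [ha, hb]⟩
      neg_mem' := by
        rintro a ⟨m, hm, ha⟩
        exact ⟨-m, M.neg_mem hm, by simp [ha]⟩ }
  obtain ⟨a, ha⟩ := Int.subgroup_cyclic I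
  rw [← AddSubgroup.zmultiples_eq_closure] at ha
  have hI (z : ℤ) : z ∈ I ↔ a ∣ z := by rw [ha, Int.mem_zmultiples_iff]
  have ha0 : a ≠ 0 := by
    rintro rfl
    obtain ⟨z, hz⟩ := hh m₀ hm₀
    have : z ∈ I := ⟨m₀, hm₀, hz⟩
    rw [hI, zero_dvd_iff] at this
    simp [hz, this] at h₀
  refine ⟨a.natAbs, by positivity, fun m hm ↦ ?_, ?_⟩
  · obtain ⟨z, hz⟩ := hh m hm
    have : z ∈ I := ⟨m, hm, hz⟩
    rw [hI, ← Int.natAbs_dvd] at this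
    obtain ⟨w, hw⟩ := this
    exact ⟨w, by rw [hz, hw]; push_cast; simp⟩
  · have : ((a.natAbs : ℕ) : ℤ) ∈ I := by rw [hI, Int.dvd_natAbs]
    obtain ⟨m, hm, h'⟩ := this
    exact ⟨m, hm, by rw [h']; simp⟩

variable [FiniteDimensional ℝ V] (M : Submodule ℤ V) [DiscreteTopology M] [IsZLattice ℝ M]

theorem exists_isIntegralOn_extension (φ : M →ₗ[ℤ] ℤ) :
    ∃ h : Dual ℝ V, ∀ m : M, h m = φ m := by
  let b := Module.finBasis ℤ M
  let B := b.ofZLatticeBasis ℝ M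
  refine ⟨B.constr ℝ fun i ↦ (φ (b i) : ℝ), fun m ↦ ?_⟩
  have : ((B.constr ℝ fun i ↦ (φ (b i) : ℝ)).restrictScalars ℤ).comp M.subtype =
      (Int.castAddHom ℝ).toIntLinearMap.comp φ := by
    refine b.ext fun i ↦ ?_
    have : (b i : V) = B i := (b.ofZLatticeBasis_apply ℝ M i).symm
    simp [this]
  exact LinearMap.congr_fun this m

/-- A point of the lattice no positive multiple of which lies in the subgroup `N` is detected by an
integral functional vanishing on `N`. -/
theorem exists_isIntegralOn_ne_zero {N : Submodule ℤ V} {x : V} (hx : x ∈ M)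
    (hxN : ∀ k : ℕ, 0 < k → k • x ∉ N) :
    ∃ h : Dual ℝ V, IsIntegralOn M h ∧ (∀ y ∈ N, y ∈ M → h y = 0) ∧ h x ≠ 0 := by
  let N' : Submodule ℤ M := N.comap M.subtype
  let T := Submodule.torsion ℤ (M ⧸ N')
  -- Modulo torsion the quotient is free, so integer functionals separate its points; the class of
  -- `x` survives because it is not torsion.
  have : Module.Free ℤ ((M ⧸ N') ⧸ T) := inferInstance
  let π : M →ₗ[ℤ] (M ⧸ N') ⧸ T := T.mkQ.comp N'.mkQ
  have hπ : π ⟨x, hx⟩ ≠ 0 := by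
    intro h
    have h' : N'.mkQ ⟨x, hx⟩ ∈ T := by simpa [π] using h
    obtain ⟨a, ha⟩ := (Submodule.mem_torsion_iff _).1 h'
    have ha0 : (a : ℤ) ≠ 0 := nonZeroDivisors.ne_zero a.2
    have ha' : (a : ℤ) • x ∈ N := by
      have : N'.mkQ ((a : ℤ) • ⟨x, hx⟩) = 0 := by rw [map_smul]; exact ha
      rw [Submodule.mkQ_apply, Submodule.Quotient.mk_eq_zero] at this
      exact this
    refine hxN (a : ℤ).natAbs (by positivity) ?_
    rw [← natCast_zsmul]
    rcases Int.natAbs_eq (a : ℤ) with h | h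
    · rwa [← h]
    · rw [h, neg_smul] at ha'
      simpa using N.neg_mem ha'
  obtain ⟨φ, hφ⟩ := not_forall.1 (mt (Module.forall_dual_apply_eq_zero_iff ℤ _).1 hπ)
  obtain ⟨h, hh⟩ := exists_isIntegralOn_extension M (φ.comp π)
  refine ⟨h, fun m hm ↦ ⟨_, hh ⟨m, hm⟩⟩, fun y hy hyM ↦ ?_, ?_⟩
  · have : N'.mkQ ⟨y, hyM⟩ = 0 := by
      rw [Submodule.mkQ_apply, Submodule.Quotient.mk_eq_zero]; exact hy
    rw [show h y = _ from hh ⟨y, hyM⟩]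
    simp only [π, LinearMap.comp_apply, this, map_zero, Int.cast_zero]
  · rw [show h x = _ from hh ⟨x, hx⟩]
    simpa using hφ

/-- Otherwise an integral functional vanishes on `Z`, hence on its real span, but not at `x`. -/
theorem exists_nsmul_mem_span_int {Z : Set V} (hZ : Z ⊆ M) {x : V} (hx : x ∈ M)
    (hxZ : x ∈ Submodule.span ℝ Z) : ∃ k : ℕ, 0 < k ∧ k • x ∈ Submodule.span ℤ Z := by
  by_contra! hcon
  obtain ⟨h, -, hN, hne⟩ := exists_isIntegralOn_ne_zero M hx hcon
  refine hne ?_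
  have : Submodule.span ℝ Z ≤ LinearMap.ker h :=
    Submodule.span_le.2 fun z hz ↦ hN z (Submodule.subset_span hz) (hZ hz)
  exact this hxZ

end Lattice

/-! ### Primitive generators of the extremal rays of the dual cone -/

namespace IsPrimitiveRayGenerator

variable {V : Type*} [NormedAddCommGroup V] [NormedSpace ℝ V] {M : Submodule ℤ V}
  {G : Set V} {v w : Dual ℝ V}

theorem nonneg {C : PointedCone ℝ V} (hv : IsPrimitiveRayGenerator M C v) {x : V} (hx : x ∈ C) :
    0 ≤ v x :=
  hv.2.1.le (Submodule.subset_span rfl) hx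

/-- Since `G` is finite, v + t h and v - t h are both nonnegative on it for small t > 0. Their sum
2v lies on the extremal ray, so each summand does. -/
theorem exists_eq_smul (hG : G.Finite) (hv : IsPrimitiveRayGenerator M (PointedCone.hull ℝ G) v)
    {h : Dual ℝ V} (hh : ∀ g ∈ G, v g = 0 → h g = 0) : ∃ c : ℝ, h = c • v := by
  have hvG (g : V) (hg : g ∈ G) : 0 ≤ v g := hv.nonneg (Submodule.subset_span hg)
  have : ∀ᶠ t : ℝ in 𝓝[>] 0, ∀ g ∈ G, |t * h g| ≤ v g := by
    refine (eventually_all_finite hG).2 fun g hg ↦ ?_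
    rcases (hvG g hg).eq_or_lt with h0 | h0
    · simp [hh g hg h0.symm, ← h0]
    · have : Continuous fun t : ℝ ↦ |t * h g| := by fun_prop
      have ht := this.tendsto 0
      simp only [zero_mul, abs_zero] at ht
      filter_upwards [(tendsto_nhdsWithin_of_tendsto_nhds ht).eventually_lt_const h0] with t ht
      exact ht.le
  obtain ⟨t, ht, ht0⟩ := (this.and self_mem_nhdsWithin).exists
  have h₁ : v + t • h ∈ PointedCone.dual (Dual.eval ℝ V) (PointedCone.hull ℝ G : Set V) := by
    rw [PointedCone.dual_hull]
    intro g hg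
    have := abs_le.1 (ht g hg)
    simp only [Dual.eval_apply, LinearMap.add_apply, LinearMap.smul_apply, smul_eq_mul]
    linarith
  have h₂ : v - t • h ∈ PointedCone.dual (Dual.eval ℝ V) (PointedCone.hull ℝ G : Set V) := by
    rw [PointedCone.dual_hull]
    intro g hg
    have := abs_le.1 (ht g hg)
    simp only [Dual.eval_apply, LinearMap.sub_apply, LinearMap.smul_apply, smul_eq_mul]
    linarith
  have h₃ := hv.2.1.mem_of_add_mem_left h₁ h₂ (by
    have : v ∈ PointedCone.hull ℝ {v} := Submodule.subset_span rfl
    convert add_mem this this using 1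
    module)
  obtain ⟨⟨l, hl⟩, hl'⟩ := Submodule.mem_span_singleton.1 h₃
  have hl' : l • v = v + t • h := hl'
  refine ⟨t⁻¹ * (l - 1), ?_⟩
  have : t • h = (l - 1) • v := by
    ext y
    have := LinearMap.congr_fun hl' y
    simp only [LinearMap.smul_apply, LinearMap.add_apply, smul_eq_mul] at this ⊢
    linarith
  rw [mul_smul, ← this, inv_smul_smul₀ ht0.ne']

theorem exists_pos_of_mem (hv : IsPrimitiveRayGenerator M (PointedCone.hull ℝ G) v)
    (hG : Submodule.span ℝ G = ⊤) : ∃ x ∈ G, 0 < v x := by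
  by_contra! hcon
  refine hv.1 (LinearMap.ext_on hG fun x hx ↦ ?_)
  exact le_antisymm (hcon x hx) (hv.nonneg (Submodule.subset_span hx))

theorem exists_eq_one {C : PointedCone ℝ V} (hv : IsPrimitiveRayGenerator M C v)
    (hM : Submodule.span ℝ (M : Set V) = ⊤) : ∃ m ∈ M, v m = 1 := by
  obtain ⟨m₀, hm₀, h₀⟩ : ∃ m ∈ M, v m ≠ 0 := by
    by_contra! hcon
    exact hv.1 (LinearMap.ext_on hM fun x hx ↦ hcon x hx)
  obtain ⟨d, hd, hd', m, hm, hmd⟩ := hv.2.2.1.exists_generator hm₀ h₀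
  have hd0 : (d : ℝ) ≠ 0 := by positivity
  have := hv.2.2.2 ((d : ℝ)⁻¹ • v) d (fun m hm ↦ by
    obtain ⟨z, hz⟩ := hd' m hm
    exact ⟨z, by simp [hz, hd0]⟩) (by
    rw [← Nat.cast_smul_eq_nsmul ℝ, smul_inv_smul₀ hd0])
  exact ⟨m, hm, by rw [hmd, this]; simp⟩

/-- By extremality `w` is a nonnegative multiple of `v`; both are integral and take the value 1 on
`M`, so the factor is 1. -/
theorem eq_of_zeros_subset (hG : G.Finite) (hGs : Submodule.span ℝ G = ⊤)
    (hM : Submodule.span ℝ (M : Set V) = ⊤)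
    (hv : IsPrimitiveRayGenerator M (PointedCone.hull ℝ G) v)
    (hw : IsPrimitiveRayGenerator M (PointedCone.hull ℝ G) w)
    (h : ∀ g ∈ G, v g = 0 → w g = 0) : v = w := by
  obtain ⟨c, rfl⟩ := hv.exists_eq_smul hG h
  obtain ⟨g, hg, hgv⟩ := hv.exists_pos_of_mem hGs
  obtain ⟨m, hm, hmv⟩ := hv.exists_eq_one hM
  obtain ⟨m', hm', hmw⟩ := hw.exists_eq_one hM
  obtain ⟨z, hz⟩ := hw.2.2.1 m hm
  obtain ⟨z', hz'⟩ := hv.2.2.1 m' hm'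
  have hc : 0 ≤ c := by
    have : 0 ≤ c * v g := hw.nonneg (Submodule.subset_span hg)
    exact nonneg_of_mul_nonneg_left this hgv
  simp only [LinearMap.smul_apply, smul_eq_mul, hmv, mul_one, hz'] at hz hmw
  rw [hz] at hmw hc
  have hzz : z * z' = 1 := by exact_mod_cast hmw
  have hz0 : 0 ≤ z := by exact_mod_cast hc
  have : z = 1 := by
    rcases Int.eq_one_or_neg_one_of_mul_eq_one hzz with h | h <;> omega
  rw [hz, this]; simp

theorem finite (hG : G.Finite) (hGs : Submodule.span ℝ G = ⊤)
    (hM : Submodule.span ℝ (M : Set V) = ⊤) :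
    {v : Dual ℝ V | IsPrimitiveRayGenerator M (PointedCone.hull ℝ G) v}.Finite := by
  refine Set.Finite.of_finite_image (f := fun v ↦ {g ∈ G | v g = 0})
    (hG.finite_subsets.subset ?_) fun v hv w hw h ↦ ?_
  · rintro _ ⟨v, -, rfl⟩
    exact Set.sep_subset _ _
  · refine eq_of_zeros_subset hG hGs hM hv hw fun g hg h0 ↦ ?_
    have : g ∈ {g ∈ G | v g = 0} := ⟨hg, h0⟩
    rw [show {g ∈ G | v g = 0} = {g ∈ G | w g = 0} from h] at this
    exact this.2

end IsPrimitiveRayGenerator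

/-! ### Description of the cone by its primitive facet functionals -/

section Rays

variable {V : Type*} [NormedAddCommGroup V] [NormedSpace ℝ V]

/-- A point outside a full-dimensional finitely generated cone is separated from it by a functional
that spans an extremal ray of the dual cone. -/
theorem exists_extremal_neg {G : Finset V} (hGs : Submodule.span ℝ (G : Set V) = ⊤)
    {x : V} (hx : x ∉ PointedCone.hull ℝ (G : Set V)) :
    ∃ f : Dual ℝ V, (∀ g ∈ G, 0 ≤ f g) ∧ f x < 0 ∧
      ∀ h : Dual ℝ V, (∀ g ∈ G, f g = 0 → h g = 0) → ∃ c : ℝ, h = c • f := by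
  classical
  let A : Set (Dual ℝ V) := {f | (∀ g ∈ G, 0 ≤ f g) ∧ f x < 0}
  have hA : A.Nonempty := PointedCone.exists_dual_neg_of_notMem_hull G id (by simpa using hx)
  let μ : Dual ℝ V → ℕ := fun f ↦ (G.filter fun g ↦ f g ≠ 0).card
  -- Minimize the number of generators where a separating functional is nonzero. If `f` were not
  -- extremal, moving it in a direction `k` with `k x = 0` would make one more generator vanish.
  obtain ⟨f, ⟨hf, hfx⟩, hmin⟩ := (measure μ).wf.has_min A hA
  refine ⟨f, hf, hfx, fun h hh ↦ ?_⟩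
  by_contra! hcon
  obtain ⟨k, hkx, hkG, g₁, hg₁, hk₁⟩ : ∃ k : Dual ℝ V, k x = 0 ∧ (∀ g ∈ G, f g = 0 → k g = 0) ∧
      ∃ g ∈ G, k g < 0 := by
    let k := h - (h x / f x) • f
    have hkx : k x = 0 := by simp [k, hfx.ne]
    have hkG : ∀ g ∈ G, f g = 0 → k g = 0 := fun g hg h0 ↦ by simp [k, h0, hh g hg h0]
    have hk : ∃ g ∈ G, k g ≠ 0 := by
      by_contra! h0
      have : k = 0 := LinearMap.ext_on hGs fun g hg ↦ h0 g hg
      exact hcon (h x / f x) (sub_eq_zero.1 this)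
    obtain ⟨g, hg, hkg⟩ := hk
    rcases hkg.lt_or_gt with hlt | hgt
    · exact ⟨k, hkx, hkG, g, hg, hlt⟩
    · exact ⟨-k, by simp [hkx], fun g hg h0 ↦ by simp [hkG g hg h0], g, hg, by simpa using hgt⟩
  obtain ⟨g₀, hg₀, hg₀min⟩ := Finset.exists_min_image (G.filter fun g ↦ k g < 0)
    (fun g ↦ f g / -k g) ⟨g₁, by simp [hg₁, hk₁]⟩
  simp only [Finset.mem_filter, and_imp] at hg₀ hg₀min
  obtain ⟨hg₀, hk₀⟩ := hg₀
  -- The largest t for which f + t k is still nonnegative on all generators; it vanishes at `g₀`.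
  set t := f g₀ / -k g₀ with ht
  have ht0 : 0 ≤ t := div_nonneg (hf g₀ hg₀) (by linarith)
  refine hmin (f + t • k) ⟨fun g hg ↦ ?_, by simpa [hkx] using hfx⟩ ?_
  · simp only [LinearMap.add_apply, LinearMap.smul_apply, smul_eq_mul]
    rcases le_or_gt 0 (k g) with h0 | h0
    · have := hf g hg; positivity
    · have := hg₀min g hg h0
      rw [le_div_iff₀ (by linarith)] at this
      linarith
  · refine Finset.card_lt_card (Finset.ssubset_iff_of_subset ?_ |>.2 ⟨g₀, ?_, ?_⟩)
    · intro g
      simp only [Finset.mem_filter, and_imp]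
      refine fun hg h1 ↦ ⟨hg, fun h0 ↦ h1 ?_⟩
      simp [h0, hkG g hg h0]
    · simp only [Finset.mem_filter, hg₀, true_and]
      exact fun h0 ↦ hk₀.ne (hkG g₀ hg₀ h0)
    · have hne : -k g₀ ≠ 0 := by linarith [hk₀] |> ne_of_gt
      have : f g₀ + t * k g₀ = 0 := by
        have := div_mul_cancel₀ (f g₀) hne
        rw [← ht] at this
        linarith
      simp [this]

variable [FiniteDimensional ℝ V] (M : Submodule ℤ V) [DiscreteTopology M] [IsZLattice ℝ M]

/-- The extremal separating functional is rational: an integral functional vanishing on the same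
generators, which lie in `M`, must be a multiple of it. Rescaling so that the value 1 is attained
makes it primitive. -/
theorem exists_isPrimitiveRayGenerator_neg {G : Finset V} (hGM : (G : Set V) ⊆ M)
    (hGs : Submodule.span ℝ (G : Set V) = ⊤)
    {x : V} (hx : x ∉ PointedCone.hull ℝ (G : Set V)) :
    ∃ v, IsPrimitiveRayGenerator M (PointedCone.hull ℝ (G : Set V)) v ∧ v x < 0 := by
  obtain ⟨f, hf, hfx, hext⟩ := exists_extremal_neg hGs hx
  have hf0 : f ≠ 0 := by rintro rfl; simp at hfx
  obtain ⟨m₀, hm₀, hfm₀⟩ : ∃ m ∈ M, f m ≠ 0 := by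
    by_contra! hcon
    exact hf0 (LinearMap.ext_on (IsZLattice.span_top (K := ℝ) (L := M)) fun x hx ↦ hcon x hx)
  let Z : Set V := {g | g ∈ G ∧ f g = 0}
  have hZ : Submodule.span ℤ Z ≤ (LinearMap.ker f).restrictScalars ℤ :=
    Submodule.span_le.2 fun g hg ↦ hg.2
  obtain ⟨h, hint, hhZ, hhm₀⟩ := exists_isIntegralOn_ne_zero M (N := Submodule.span ℤ Z) hm₀ (by
    intro k hk hkm
    have : f (k • m₀) = 0 := hZ hkm
    rw [map_nsmul, nsmul_eq_mul, mul_eq_zero] at this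
    rcases this with h | h
    · exact hk.ne' (by exact_mod_cast h)
    · exact hfm₀ h)
  obtain ⟨c, hc⟩ := hext h fun g hg h0 ↦ hhZ g (Submodule.subset_span ⟨hg, h0⟩) (hGM hg)
  have hc0 : c ≠ 0 := by rintro rfl; simp [hc] at hhm₀
  -- The sign of `c` is not known, so the positive scalar `a` is |c| / d, with `d` the generator of
  -- the values of `h`.
  obtain ⟨a, ha, hint, hone⟩ : ∃ a : ℝ, 0 < a ∧ IsIntegralOn M (a • f) ∧
      ∃ m ∈ M, (a • f) m = 1 := by
    obtain ⟨d, hd, hd', m, hm, hmd⟩ := hint.exists_generator hm₀ hhm₀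
    have hd0 : 0 < (d : ℝ) := by positivity
    have h' (m : V) : h m = c * f m := by simp [hc]
    rcases hc0.lt_or_gt with hneg | hpos
    · refine ⟨(-c) / d, div_pos (by linarith) hd0, fun m hm ↦ ?_, -m, M.neg_mem hm, ?_⟩
      · obtain ⟨z, hz⟩ := hd' m hm
        refine ⟨-z, ?_⟩
        rw [h'] at hz
        simp only [LinearMap.smul_apply, smul_eq_mul]
        rw [div_mul_eq_mul_div, neg_mul, hz]
        field_simp
        push_cast
        ring
      · rw [h'] at hmd
        simp only [LinearMap.smul_apply, smul_eq_mul, map_neg]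
        rw [div_mul_eq_mul_div, neg_mul, neg_div, neg_neg, hmd, div_self hd0.ne']
    · refine ⟨c / d, div_pos hpos hd0, fun m hm ↦ ?_, m, hm, ?_⟩
      · obtain ⟨z, hz⟩ := hd' m hm
        refine ⟨z, ?_⟩
        rw [h'] at hz
        simp only [LinearMap.smul_apply, smul_eq_mul]
        rw [div_mul_eq_mul_div, hz]
        field_simp
      · rw [h'] at hmd
        simp only [LinearMap.smul_apply, smul_eq_mul]
        rw [div_mul_eq_mul_div, hmd, div_self hd0.ne']
  refine ⟨a • f, ⟨smul_ne_zero ha.ne' hf0, ?_, hint, ?_⟩, ?_⟩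
  · refine .of_mem_of_add_mem_left (Submodule.span_le.2 ?_) fun {b b'} hb hb' hbb ↦ ?_
    · rintro _ rfl
      rw [PointedCone.dual_hull, SetLike.mem_coe]
      intro g hg
      have := hf g hg
      simp only [Dual.eval_apply, LinearMap.smul_apply, smul_eq_mul]
      positivity
    · rw [PointedCone.dual_hull] at hb hb'
      obtain ⟨⟨l, hl⟩, hl'⟩ := Submodule.mem_span_singleton.1 hbb
      have hl' : l • a • f = b + b' := hl'
      obtain ⟨μ, rfl⟩ := hext b fun g hg h0 ↦ by
        have h₁ : 0 ≤ b g := hb hg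
        have h₂ : 0 ≤ b' g := hb' hg
        have h₃ := LinearMap.congr_fun hl' g
        simp only [LinearMap.smul_apply, h0, smul_zero, LinearMap.add_apply] at h₃
        linarith
      have hμ : 0 ≤ μ := by
        obtain ⟨g, hg, hfg⟩ : ∃ g ∈ G, 0 < f g := by
          by_contra! hcon
          exact hf0 (LinearMap.ext_on hGs fun g hg ↦ le_antisymm (hcon g hg) (hf g hg))
        have : 0 ≤ μ * f g := hb hg
        exact nonneg_of_mul_nonneg_left this hfg
      have : (⟨μ / a, by positivity⟩ : {c : ℝ // 0 ≤ c}) • a • f = μ • f := by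
        change (μ / a) • a • f = _
        rw [smul_smul, div_mul_cancel₀ _ ha.ne']
      rw [← this]
      exact Submodule.smul_mem _ _ (Submodule.subset_span rfl)
  · intro w n hw hn
    obtain ⟨m, hm, hm1⟩ := hone
    obtain ⟨z, hz⟩ := hw m hm
    rw [hn, LinearMap.smul_apply, hz, nsmul_eq_mul] at hm1
    have : (n : ℤ) * z = 1 := by exact_mod_cast hm1
    rcases Int.eq_one_or_neg_one_of_mul_eq_one this with h | h <;> omega
  · simpa using mul_neg_of_pos_of_neg ha hfx

theorem mem_hull_iff_forall_isPrimitiveRayGenerator {G : Finset V} (hGM : (G : Set V) ⊆ M)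
    (hGs : Submodule.span ℝ (G : Set V) = ⊤) {x : V} :
    x ∈ PointedCone.hull ℝ (G : Set V) ↔
      ∀ v, IsPrimitiveRayGenerator M (PointedCone.hull ℝ (G : Set V)) v → 0 ≤ v x := by
  refine ⟨fun hx v hv ↦ hv.nonneg hx, fun h ↦ ?_⟩
  by_contra hx
  obtain ⟨v, hv, hvx⟩ := exists_isPrimitiveRayGenerator_neg M hGM hGs hx
  exact hvx.not_ge (h v hv)

/-- If `x` is a common zero of all these functionals, then `x` and `-x` lie in the cone, so `x = 0`
by salience. -/
theorem span_isPrimitiveRayGenerator {G : Finset V} (hGM : (G : Set V) ⊆ M)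
    (hGs : Submodule.span ℝ (G : Set V) = ⊤)
    (hsal : (PointedCone.hull ℝ (G : Set V) : ConvexCone ℝ V).Salient) :
    Submodule.span ℝ {v | IsPrimitiveRayGenerator M (PointedCone.hull ℝ (G : Set V)) v} = ⊤ := by
  rw [← Subspace.dualCoannihilator_dualAnnihilator_eq
    (W := Submodule.span ℝ {v | IsPrimitiveRayGenerator M (PointedCone.hull ℝ (G : Set V)) v}),
    ← Submodule.dualAnnihilator_bot]
  congr 1
  rw [eq_bot_iff]
  intro x hx
  rw [Submodule.mem_dualCoannihilator] at hx
  have hx' : ∀ v, IsPrimitiveRayGenerator M (PointedCone.hull ℝ (G : Set V)) v → v x = 0 :=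
    fun v hv ↦ hx v (Submodule.subset_span hv)
  by_contra h0
  refine hsal x ?_ h0 ?_
  · exact (mem_hull_iff_forall_isPrimitiveRayGenerator M hGM hGs).2 fun v hv ↦ (hx' v hv).ge
  · exact (mem_hull_iff_forall_isPrimitiveRayGenerator M hGM hGs).2 fun v hv ↦ by
      rw [map_neg, hx' v hv, neg_zero]

theorem isBounded_of_forall_dual {P : Set V} (h : ∀ f : Dual ℝ V, ∃ B : ℝ, ∀ x ∈ P, |f x| ≤ B) :
    Bornology.IsBounded P := by
  let b := Module.finBasis ℝ V
  choose B hB using fun i ↦ h (b.coord i)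
  have hb : Bornology.IsBounded (b.equivFun '' P) := by
    refine (Bornology.IsBounded.pi fun i ↦ Metric.isBounded_Icc (-B i) (B i)).subset ?_
    rintro _ ⟨x, hx, rfl⟩ i -
    exact abs_le.1 (hB i x hx)
  have : P = b.equivFun.symm.toContinuousLinearEquiv '' (b.equivFun '' P) := by
    rw [Set.image_image]; simp
  rw [this]
  exact b.equivFun.symm.toContinuousLinearEquiv.lipschitz.isBounded_image hb

theorem isBounded_forall_isPrimitiveRayGenerator {G : Finset V} (hGM : (G : Set V) ⊆ M)
    (hGs : Submodule.span ℝ (G : Set V) = ⊤)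
    (hsal : (PointedCone.hull ℝ (G : Set V) : ConvexCone ℝ V).Salient) :
    Bornology.IsBounded {x : V | ∀ v, IsPrimitiveRayGenerator M (PointedCone.hull ℝ (G : Set V)) v →
      0 ≤ v x ∧ v x < 1} := by
  refine isBounded_of_forall_dual fun f ↦ ?_
  have hf : f ∈ Submodule.span ℝ
      {v | IsPrimitiveRayGenerator M (PointedCone.hull ℝ (G : Set V)) v} := by
    rw [span_isPrimitiveRayGenerator M hGM hGs hsal]; trivial
  induction hf using Submodule.span_induction with
  | mem v hv =>
    exact ⟨1, fun x hx ↦ by rw [abs_of_nonneg (hx v hv).1]; exact (hx v hv).2.le⟩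
  | zero => exact ⟨0, by simp⟩
  | add f g _ _ hf hg =>
    obtain ⟨B, hB⟩ := hf
    obtain ⟨B', hB'⟩ := hg
    exact ⟨B + B', fun x hx ↦ (abs_add_le _ _).trans (add_le_add (hB x hx) (hB' x hx))⟩
  | smul c f _ hf =>
    obtain ⟨B, hB⟩ := hf
    refine ⟨|c| * B, fun x hx ↦ ?_⟩
    simp only [LinearMap.smul_apply, smul_eq_mul, abs_mul]
    exact mul_le_mul_of_nonneg_left (hB x hx) (abs_nonneg c)

end Rays

/-! ### Face lattices, relative saturation and seminormality -/

section Faces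

variable {V : Type*} [NormedAddCommGroup V] [NormedSpace ℝ V] {S : AddSubmonoid V}
  {D D' : PointedCone ℝ V} {x : V}

theorem subset_monoidCone : (S : Set V) ⊆ monoidCone S := Submodule.subset_span

theorem monoidCone_eq_hull {G : Set V} (hG : AddSubmonoid.closure G = S) :
    monoidCone S = PointedCone.hull ℝ G := by
  refine le_antisymm (Submodule.span_le.2 ?_) (Submodule.span_mono ?_)
  · have : S ≤ (PointedCone.hull ℝ G).toAddSubmonoid := by
      rw [← hG]
      exact AddSubmonoid.closure_le.2 Submodule.subset_span
    exact this
  · rw [← hG]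
    exact AddSubmonoid.subset_closure

theorem faceLattice_mono (h : D ≤ D') : faceLattice S D ≤ faceLattice S D' :=
  Submodule.span_mono (Set.inter_subset_inter_right _ h)

theorem mem_faceLattice (hx : x ∈ S) (hD : x ∈ D) : x ∈ faceLattice S D :=
  Submodule.subset_span ⟨hx, hD⟩

theorem faceLattice_monoidCone : faceLattice S (monoidCone S) = Submodule.span ℤ (S : Set V) := by
  rw [faceLattice, Set.inter_eq_left.2 subset_monoidCone]

theorem faceLattice_le : faceLattice S D ≤ Submodule.span ℤ (S : Set V) :=
  Submodule.span_mono Set.inter_subset_left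

theorem PointedCone.IsFaceOf.span_inter (hD : D.IsFaceOf (monoidCone S)) :
    Submodule.span ℝ ((S : Set V) ∩ D) = Submodule.span ℝ (D : Set V) := by
  refine le_antisymm (Submodule.span_mono Set.inter_subset_right) (Submodule.span_le.2 ?_)
  have h := PointedCone.IsFaceOf.eq_hull_inter hD
  intro x hx
  rw [SetLike.mem_coe, h] at hx
  exact PointedCone.hull_le_span ℝ _ hx

theorem faceLattice_le_span :
    faceLattice S D ≤ (Submodule.span ℝ (D : Set V)).restrictScalars ℤ :=
  Submodule.span_le.2 fun _ hx ↦ Submodule.subset_span hx.2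

theorem PointedCone.IsFaceOf.exists_isRelInterior (hfg : S.FG)
    (hD : D.IsFaceOf (monoidCone S)) : ∃ s ∈ S, D.IsRelInterior s := by
  classical
  obtain ⟨G, hG⟩ := hfg
  rw [monoidCone_eq_hull hG] at hD
  have hGS : (G : Set V) ⊆ S := by rw [← hG]; exact AddSubmonoid.subset_closure
  -- The sum of the generators lying in `D` is relatively interior: any one of them can be
  -- subtracted.
  let T := G.filter (· ∈ D)
  have hT (g : V) : g ∈ T ↔ g ∈ G ∧ g ∈ D := by simp [T]
  refine ⟨∑ g ∈ T, g, sum_mem fun g hg ↦ hGS ((hT g).1 hg).1,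
    PointedCone.isRelInterior_of_subset_hull hD.eq_hull_inter.le
      (sum_mem fun g hg ↦ ((hT g).1 hg).2) ?_⟩
  rintro g ⟨hg, hgD⟩
  refine ⟨hgD, 1, one_pos, ?_⟩
  rw [one_smul, ← Finset.sum_erase_eq_sub ((hT g).2 ⟨hg, hgD⟩)]
  exact sum_mem fun g' hg' ↦ ((hT g').1 (Finset.mem_of_mem_erase hg')).2

theorem rufIntersection_isFaceOf : (rufIntersection S).IsFaceOf (monoidCone S) := by
  have h := PointedCone.IsFaceOf.sInf {D | IsRUF S D} (C := monoidCone S) fun D hD ↦ hD.1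
  rwa [inf_eq_right.2] at h
  exact sInf_le ⟨.rfl, Or.inl rfl⟩

theorem mem_rufIntersection : x ∈ rufIntersection S ↔ ∀ D, IsRUF S D → x ∈ D := by
  simp [rufIntersection]

theorem not_isRelSaturated_iff :
    ¬ IsRelSaturated S D ↔ ∃ x, x ∉ faceLattice S D ∧ x ∈ Submodule.span ℝ (D : Set V) ∧
      ∀ D' : PointedCone ℝ V, D'.IsFaceOf (monoidCone S) → D < D' → x ∈ faceLattice S D' := by
  have hle : faceLattice S D ≤
      (⨅ D' ∈ {D' : PointedCone ℝ V | D'.IsFaceOf (monoidCone S) ∧ D < D'}, faceLattice S D') ⊓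
      (Submodule.span ℝ (D : Set V)).restrictScalars ℤ :=
    le_inf (le_iInf₂ fun D' hD' ↦ faceLattice_mono hD'.2.le) faceLattice_le_span
  rw [IsRelSaturated, ← hle.ge_iff_eq, SetLike.not_le_iff_exists]
  refine exists_congr fun x ↦ ?_
  simp only [Submodule.mem_inf, Submodule.mem_iInf, Set.mem_ofPred_eq,
    Submodule.restrictScalars_mem, and_imp]
  tauto

variable [FiniteDimensional ℝ V]

theorem IsSeminormalMonoid.mem (hsemi : IsSeminormalMonoid S) (hD : D.IsFaceOf (monoidCone S))
    (hx : x ∈ faceLattice S D) (hxD : D.IsRelInterior x) : x ∈ S := by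
  have : x ∈ (faceLattice S D : Set V) ∩ intrinsicInterior ℝ (D : Set V) :=
    ⟨hx, PointedCone.mem_intrinsicInterior.2 hxD⟩
  rw [← hsemi D hD] at this
  exact this.1

/-- This is absence of q-torsion in (M ∩ ⟨D⟩)/M_D. Adding a large multiple of an interior element `s
∈ S` moves `x` into the interior of `D`; there seminormality puts the q-fold multiple in `S`, and
`hq` divides by q. -/
theorem IsSeminormalMonoid.mem_faceLattice_of_nsmul_mem (hsemi : IsSeminormalMonoid S)
    (hfg : S.FG) {q : ℕ} (hq₀ : q ≠ 0)
    (hq : ∀ x ∈ Submodule.span ℤ (S : Set V), q • x ∈ S → x ∈ S)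
    (hD : D.IsFaceOf (monoidCone S)) (hx : x ∈ Submodule.span ℤ (S : Set V))
    (hxD : x ∈ Submodule.span ℝ (D : Set V)) (hqx : q • x ∈ faceLattice S D) :
    x ∈ faceLattice S D := by
  obtain ⟨s, hs, hsD⟩ := hD.exists_isRelInterior hfg
  obtain ⟨N, hN⟩ := hsD.exists_forall_add_smul hxD
  have hN := hN N le_rfl
  rw [Nat.cast_smul_eq_nsmul] at hN
  have hsL : s ∈ faceLattice S D := mem_faceLattice hs hsD.1
  have h₁ : x + N • s ∈ S := by
    refine hq _ (add_mem hx (nsmul_mem (Submodule.subset_span hs) N)) (hsemi.mem hD ?_ ?_)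
    · rw [smul_add]
      exact add_mem hqx (nsmul_mem (nsmul_mem hsL N) q)
    · rw [← Nat.cast_smul_eq_nsmul ℝ]
      exact hN.smul (by positivity)
  have h₂ := mem_faceLattice h₁ hN.1
  simpa using sub_mem h₂ (nsmul_mem hsL N)

/-- The group (M ∩ ⟨D⟩)/M_D is torsion without p-torsion, so multiplication by p^e is surjective on
it. -/
theorem exists_sub_nsmul_mem_faceLattice (M : Submodule ℤ V) [DiscreteTopology M] [IsZLattice ℝ M]
    (hSM : Submodule.span ℤ (S : Set V) = M) (hsemi : IsSeminormalMonoid S)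
    (hfg : S.FG) {p : ℕ} (hp : p.Prime) (hpS : ∀ e : ℕ, ∀ x ∈ M, p ^ e • x ∈ S → x ∈ S)
    (hD : D.IsFaceOf (monoidCone S)) (hx : x ∈ M)
    (hxD : x ∈ Submodule.span ℝ (D : Set V)) (e : ℕ) :
    ∃ y ∈ M, y ∈ Submodule.span ℝ (D : Set V) ∧ x - p ^ e • y ∈ faceLattice S D := by
  have hZ : (S : Set V) ∩ D ⊆ M := by
    rw [← hSM]; exact Set.inter_subset_left.trans Submodule.subset_span
  rw [← hD.span_inter] at hxD
  obtain ⟨k, hk, hkx⟩ := exists_nsmul_mem_span_int M hZ hx hxD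
  rw [hD.span_inter] at hxD
  obtain ⟨a, k, hk', rfl⟩ := Nat.exists_eq_pow_mul_and_not_dvd hk.ne' p hp.ne_one
  have hkx' : k • x ∈ faceLattice S D := by
    refine hsemi.mem_faceLattice_of_nsmul_mem hfg (pow_ne_zero a hp.ne_zero)
      (by rw [hSM]; exact hpS a) hD (by rw [hSM]; exact nsmul_mem hx k) (nsmul_mem hxD k) ?_
    rwa [smul_smul]
  have hcop : IsCoprime (k : ℤ) ((p ^ e : ℕ) : ℤ) :=
    Nat.isCoprime_iff_coprime.2 (((Nat.Prime.coprime_iff_not_dvd hp).2 hk').symm.pow_right e)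
  -- With α k + β p^e = 1, the vector x - p^e (β x) equals α (k x), which lies in M_D.
  obtain ⟨α, β, hαβ⟩ := hcop
  refine ⟨β • x, zsmul_mem hx β, zsmul_mem hxD β, ?_⟩
  have : x - p ^ e • β • x = α • k • x := by
    have h : (α * (k : ℤ) + β * ((p ^ e : ℕ) : ℤ)) • x = x := by rw [hαβ, one_smul]
    nth_rewrite 1 [← h]
    rw [add_smul, mul_smul, mul_comm β, mul_smul, natCast_zsmul, natCast_zsmul]
    abel
  rw [this]
  exact zsmul_mem hkx' α

end Faces

/-- The points `u` of `(1/q) S` such that `(1/q) S ∩ (u + M) ⊆ u + S`. -/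
def IsSplitPoint {V : Type*} [AddCommGroup V] (M : Submodule ℤ V) (S : AddSubmonoid V)
    (q : ℕ) (u : V) : Prop :=
  q • u ∈ S ∧ ∀ m ∈ M, q • (u + m) ∈ S → m ∈ S

/-! ### Facets cut out by primitive generators -/

section Facets

variable {V : Type*} [NormedAddCommGroup V] [NormedSpace ℝ V]

/-- The face of `C` on which the functional `v` vanishes. -/
def PointedCone.zeroFace (C : PointedCone ℝ V) (v : Dual ℝ V) : PointedCone ℝ V :=
  C ⊓ PointedCone.ofSubmodule (LinearMap.ker v)

theorem PointedCone.zeroFace_isFaceOf {C : PointedCone ℝ V} {v : Dual ℝ V}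
    (hv : ∀ x ∈ C, 0 ≤ v x) : (C.zeroFace v).IsFaceOf C := by
  refine .of_mem_of_add_mem_left (fun x hx ↦ hx.1) fun {x y} hx hy h ↦ ⟨hx, ?_⟩
  have h₁ : v (x + y) = 0 := h.2
  have := hv x hx
  have := hv y hy
  rw [map_add] at h₁
  change v x = 0
  linarith

variable {M : Submodule ℤ V} {G : Finset V} {v : Dual ℝ V}

/-- The zero face is a facet: by extremality, any functional vanishing on it is a multiple of `v`.
-/
theorem IsPrimitiveRayGenerator.mem_span_zeroFace
    (hv : IsPrimitiveRayGenerator M (PointedCone.hull ℝ (G : Set V)) v) {x : V} (hx : v x = 0) :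
    x ∈ Submodule.span ℝ ((PointedCone.hull ℝ (G : Set V)).zeroFace v : Set V) := by
  by_contra hcon
  obtain ⟨h, hhx, hh⟩ := Submodule.exists_le_ker_of_notMem hcon
  obtain ⟨c, rfl⟩ := hv.exists_eq_smul G.finite_toSet (h := h) fun g hg h0 ↦
    hh (Submodule.subset_span ⟨Submodule.subset_span hg, h0⟩)
  simp [hx] at hhx

/-- Subtracting a multiple of a generator `g` with `v g > 0` brings `x` into the span of the facet,
where adding enough of the interior point `s` lands in the facet itself. -/
theorem IsPrimitiveRayGenerator.eventually_add_smul_mem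
    (hv : IsPrimitiveRayGenerator M (PointedCone.hull ℝ (G : Set V)) v)
    (hGs : Submodule.span ℝ (G : Set V) = ⊤) {s : V}
    (hs : ((PointedCone.hull ℝ (G : Set V)).zeroFace v).IsRelInterior s) {x : V} (hx : 0 ≤ v x) :
    ∀ᶠ n : ℕ in atTop, x + (n : ℝ) • s ∈ PointedCone.hull ℝ (G : Set V) := by
  obtain ⟨g, hg, hgv⟩ := hv.exists_pos_of_mem hGs
  have h0 : v (x - (v x / v g) • g) = 0 := by
    simp [div_mul_cancel₀ _ hgv.ne']
  obtain ⟨N, hN⟩ := hs.exists_forall_add_smul (hv.mem_span_zeroFace h0)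
  filter_upwards [eventually_ge_atTop N] with n hn
  convert add_mem (hN n hn).1.1
    (PointedCone.smul_mem _ (div_nonneg hx hgv.le) (Submodule.subset_span hg)) using 1
  module

theorem IsPrimitiveRayGenerator.eventually_isRelInterior_add_smul
    (hv : IsPrimitiveRayGenerator M (PointedCone.hull ℝ (G : Set V)) v)
    (hGs : Submodule.span ℝ (G : Set V) = ⊤) {s : V}
    (hs : ((PointedCone.hull ℝ (G : Set V)).zeroFace v).IsRelInterior s) {x : V} (hx : 0 < v x) :
    ∀ᶠ n : ℕ in atTop, (PointedCone.hull ℝ (G : Set V)).IsRelInterior (x + (n : ℝ) • s) := by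
  have h : ∀ᶠ n : ℕ in atTop, ∀ g ∈ (G : Set V), ∃ ε : ℝ, 0 < ε ∧
      x + (n : ℝ) • s - ε • g ∈ PointedCone.hull ℝ (G : Set V) := by
    refine (eventually_all_finite G.finite_toSet).2 fun g hg ↦ ?_
    have hg0 : 0 ≤ v g := hv.nonneg (Submodule.subset_span hg)
    -- The `+ 1` keeps the denominator positive when `v g = 0`.
    have h0 : 0 ≤ v (x - (v x / (v g + 1)) • g) := by
      simp only [map_sub, map_smul, smul_eq_mul, sub_nonneg]
      rw [div_mul_eq_mul_div, div_le_iff₀ (by positivity)]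
      nlinarith
    filter_upwards [hv.eventually_add_smul_mem hGs hs h0] with n hn
    refine ⟨v x / (v g + 1), by positivity, ?_⟩
    convert hn using 1
    module
  filter_upwards [h, hv.eventually_add_smul_mem hGs hs hx.le] with n hn hn'
  exact PointedCone.isRelInterior_of_subset_hull le_rfl hn'
    fun g hg ↦ ⟨Submodule.subset_span hg, hn g hg⟩

end Facets

/-! ### Split points are the points of (1/q)S in P_S -/

section SplitPoints

variable {V : Type*} [NormedAddCommGroup V] [NormedSpace ℝ V] {S : AddSubmonoid V}

theorem exists_finset_generators (M : Submodule ℤ V) [DiscreteTopology M] [IsZLattice ℝ M]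
    (hfg : S.FG) (hSM : Submodule.span ℤ (S : Set V) = M) :
    ∃ G : Finset V, (G : Set V) ⊆ M ∧ Submodule.span ℝ (G : Set V) = ⊤ ∧
      monoidCone S = PointedCone.hull ℝ (G : Set V) := by
  obtain ⟨G, hG⟩ := hfg
  have hGS : (G : Set V) ⊆ S := by rw [← hG]; exact AddSubmonoid.subset_closure
  have hSM' : (S : Set V) ⊆ M := by rw [← hSM]; exact Submodule.subset_span
  refine ⟨G, hGS.trans hSM', ?_, monoidCone_eq_hull hG⟩
  rw [eq_top_iff, ← IsZLattice.span_top (K := ℝ) (L := M), Submodule.span_le, ← hSM]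
  have h₁ : S ≤ (Submodule.span ℝ (G : Set V)).toAddSubmonoid := by
    rw [← hG]
    exact AddSubmonoid.closure_le.2 Submodule.subset_span
  have h₂ : Submodule.span ℤ (S : Set V) ≤ (Submodule.span ℝ (G : Set V)).restrictScalars ℤ :=
    Submodule.span_le.2 h₁
  exact h₂

theorem nsmul_mem_cone_iff {C : PointedCone ℝ V} {q : ℕ} (hq : q ≠ 0) {x : V} :
    q • x ∈ C ↔ x ∈ C := by
  rw [← Nat.cast_smul_eq_nsmul ℝ]
  exact C.smul_mem_iff (by positivity)

theorem IsSplitPoint.mem_cone {M : Submodule ℤ V} {q : ℕ} (hq : q ≠ 0) {u : V}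
    (hu : IsSplitPoint M S q u) : u ∈ monoidCone S :=
  (nsmul_mem_cone_iff hq).1 (subset_monoidCone hu.1)

/-- Every point of `D_S` can be scaled into the splitting polytope. -/
theorem eventually_smul_mem_splittingPolytope {M : Submodule ℤ V} [DiscreteTopology M]
    [IsZLattice ℝ M] (hfg : S.FG) (hSM : Submodule.span ℤ (S : Set V) = M) {x : V}
    (hx : x ∈ rufIntersection S) :
    ∀ᶠ t : ℝ in 𝓝[>] 0, t • x ∈ splittingPolytope M S := by
  obtain ⟨G, hGM, hGs, hG⟩ := exists_finset_generators M hfg hSM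
  have hfin := IsPrimitiveRayGenerator.finite (M := M) G.finite_toSet hGs
    (IsZLattice.span_top (K := ℝ) (L := M))
  rw [← hG] at hfin
  have h : ∀ᶠ t : ℝ in 𝓝[>] 0, ∀ v ∈ {v | IsPrimitiveRayGenerator M (monoidCone S) v},
      v (t • x) < 1 := by
    refine (eventually_all_finite hfin).2 fun v _ ↦ ?_
    have hc : Continuous fun t : ℝ ↦ v (t • x) := by
      simp only [map_smul, smul_eq_mul]; fun_prop
    have ht := hc.tendsto 0
    simp only [zero_smul, map_zero] at ht
    exact (tendsto_nhdsWithin_of_tendsto_nhds ht).eventually_lt_const one_pos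
  filter_upwards [h, self_mem_nhdsWithin] with t ht ht0
  have htx := (rufIntersection S).smul_mem (le_of_lt ht0) hx
  exact ⟨fun v hv ↦ ⟨hv.nonneg (rufIntersection_isFaceOf.le htx), ht v hv⟩, htx⟩

/-- If `u` misses an RUF `D`, take `m` in ⟨D⟩ and in M_{D'} for all larger faces, but not in M_D,
and push it into the interior of `D`. The smallest face containing m + u strictly contains `D`, so
seminormality there gives q(u + m) ∈ S. Splitness then puts `m` in S ∩ D, a contradiction. -/
theorem IsSplitPoint.mem_rufIntersection [FiniteDimensional ℝ V] {M : Submodule ℤ V}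
    (hfg : S.FG) (hSM : Submodule.span ℤ (S : Set V) = M)
    (hsemi : IsSeminormalMonoid S) {q : ℕ} (hq : q ≠ 0) {u : V}
    (hu : IsSplitPoint M S q u) : u ∈ rufIntersection S := by
  refine _root_.mem_rufIntersection.2 fun D hD ↦ ?_
  obtain ⟨hD, rfl | hsat⟩ := hD
  · exact hu.mem_cone hq
  by_contra huD
  obtain ⟨m, hmD, hmspan, hm⟩ := not_isRelSaturated_iff.1 hsat
  obtain ⟨s, hs, hsD⟩ := hD.exists_isRelInterior hfg
  obtain ⟨N, hN⟩ := hsD.exists_forall_add_smul hmspan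
  have hN := hN N le_rfl
  rw [Nat.cast_smul_eq_nsmul] at hN
  have hmu : m + N • s + u ∈ monoidCone S := add_mem (hD.le hN.1) (hu.mem_cone hq)
  have hD' := PointedCone.minFace_isFaceOf hmu
  obtain ⟨hm', hu'⟩ := (hD'.add_mem_iff_mem (hD.le hN.1) (hu.mem_cone hq)).1
    (PointedCone.self_mem_minFace hmu)
  have hDD' : D < (monoidCone S).minFace _ hmu :=
    lt_of_le_of_ne (hN.le_of_mem_face hD.le hD' hm') fun h ↦ huD (h ▸ hu')
  have hmN : m + N • s ∉ faceLattice S D := fun h ↦ hmD (by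
    simpa using sub_mem h (nsmul_mem (mem_faceLattice hs hsD.1) N))
  refine hmN (mem_faceLattice (hu.2 _ ?_ ?_) hN.1)
  · rw [← hSM]
    exact add_mem (faceLattice_le (hm _ hD' hDD')) (nsmul_mem (Submodule.subset_span hs) N)
  · refine hsemi.mem hD' ?_ ?_
    · rw [smul_add]
      refine add_mem (mem_faceLattice hu.1 (nsmul_mem hu' q))
        (nsmul_mem (add_mem (hm _ hD' hDD') ?_) q)
      exact nsmul_mem (mem_faceLattice hs (hDD'.le hsD.1)) N
    · rw [add_comm u, ← Nat.cast_smul_eq_nsmul ℝ q]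
      exact (PointedCone.isRelInterior_minFace hmu).smul (by positivity)

variable [FiniteDimensional ℝ V] {M : Submodule ℤ V} [DiscreteTopology M] [IsZLattice ℝ M]

/-- If `v u ≥ 1`, an `m ∈ M` with `v m = -1` and q(u + m) ∈ S is built. Splitness would put it in
`S`, where `v` is nonnegative. -/
theorem IsSplitPoint.apply_lt_one (hfg : S.FG) (hSM : Submodule.span ℤ (S : Set V) = M)
    (hsemi : IsSeminormalMonoid S) {p : ℕ} (hp : p.Prime)
    (hpS : ∀ e : ℕ, ∀ x ∈ M, p ^ e • x ∈ S → x ∈ S) {e : ℕ} {u : V}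
    (hu : IsSplitPoint M S (p ^ e) u) {v : Dual ℝ V}
    (hv : IsPrimitiveRayGenerator M (monoidCone S) v) : v u < 1 := by
  by_contra! hvu
  have hq : p ^ e ≠ 0 := pow_ne_zero e hp.ne_zero
  have hSM' {x : V} (hx : x ∈ S) : x ∈ M := by rw [← hSM]; exact Submodule.subset_span hx
  obtain ⟨G, hGM, hGs, hG⟩ := exists_finset_generators M hfg hSM
  have hF := PointedCone.zeroFace_isFaceOf fun x hx ↦ hv.nonneg (x := x) hx
  obtain ⟨s, hs, hsF⟩ := hF.exists_isRelInterior hfg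
  obtain ⟨m₁, hm₁, hvm₁⟩ := hv.exists_eq_one (IsZLattice.span_top (K := ℝ) (L := M))
  have hcontra {m : V} (hm : m ∈ M) (hvm : v m = -1) (h : p ^ e • (u + m) ∈ S) : False := by
    have := hv.nonneg (subset_monoidCone (hu.2 m hm h))
    linarith
  have hv' := hv
  rw [hG] at hv'
  have hvs : v s = 0 := hsF.1.2
  rcases hvu.eq_or_lt with hvu | hvu
  · have hy : v (u - m₁) = 0 := by rw [map_sub, ← hvu, hvm₁, sub_self]
    have hyF := hv'.mem_span_zeroFace hy
    rw [← hG] at hyF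
    obtain ⟨t, ht, htF, hyt⟩ := exists_sub_nsmul_mem_faceLattice M hSM hsemi hfg hp hpS hF
      (x := p ^ e • (u - m₁))
      (by rw [smul_sub]; exact sub_mem (hSM' hu.1) (nsmul_mem hm₁ _)) (nsmul_mem hyF _) e
    obtain ⟨N, hN⟩ := hsF.exists_forall_add_smul (sub_mem hyF htF)
    have hN := hN N le_rfl
    have hvt : v t = 0 := by
      have : Submodule.span ℝ ((monoidCone S).zeroFace v : Set V) ≤ LinearMap.ker v :=
        Submodule.span_le.2 fun x hx ↦ hx.2
      exact this htF
    refine hcontra (m := -m₁ - t + N • s) (add_mem (sub_mem (neg_mem hm₁) ht)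
      (nsmul_mem (hSM' hs) N)) (by simp [hvm₁, hvt, hvs]) (hsemi.mem hF ?_ ?_)
    · convert add_mem hyt (nsmul_mem (nsmul_mem (mem_faceLattice hs hsF.1) N) (p ^ e)) using 1
      simp only [smul_add, smul_sub, smul_neg]
      abel
    · rw [← Nat.cast_smul_eq_nsmul ℝ]
      convert hN.smul (c := ((p ^ e : ℕ) : ℝ)) (by positivity) using 1
      rw [← Nat.cast_smul_eq_nsmul ℝ N]
      module
  · have hy : 0 < v (u - m₁) := by rw [map_sub, hvm₁]; linarith
    rw [hG] at hsF
    obtain ⟨N, hN⟩ := (hv'.eventually_isRelInterior_add_smul hGs hsF hy).exists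
    rw [← hG] at hN
    refine hcontra (m := -m₁ + N • s) (add_mem (neg_mem hm₁)
      (nsmul_mem (hSM' hs) N)) (by simp [hvm₁, hvs]) (hsemi.mem .rfl ?_ ?_)
    · rw [faceLattice_monoidCone, hSM, smul_add]
      exact add_mem (hSM' hu.1) (nsmul_mem (add_mem (neg_mem hm₁) (nsmul_mem (hSM' hs) N)) _)
    · rw [← Nat.cast_smul_eq_nsmul ℝ]
      convert hN.smul (c := ((p ^ e : ℕ) : ℝ)) (by positivity) using 1
      rw [← Nat.cast_smul_eq_nsmul ℝ N]
      module

theorem isSplitPoint_of_mem_splittingPolytope (hfg : S.FG)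
    (hSM : Submodule.span ℤ (S : Set V) = M) (hsemi : IsSeminormalMonoid S) {q : ℕ} (hq : q ≠ 0)
    (hqS : ∀ x ∈ M, q • x ∈ S → x ∈ S) {u : V}
    (huS : q • u ∈ S) (hu : u ∈ splittingPolytope M S) : IsSplitPoint M S q u := by
  refine ⟨huS, fun m hm hmu ↦ ?_⟩
  obtain ⟨G, hGM, hGs, hG⟩ := exists_finset_generators M hfg hSM
  have hmuC : u + m ∈ monoidCone S := (nsmul_mem_cone_iff hq).1 (subset_monoidCone hmu)
  have hmC : m ∈ monoidCone S := by
    rw [hG, mem_hull_iff_forall_isPrimitiveRayGenerator M hGM hGs, ← hG]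
    intro v hv
    obtain ⟨z, hz⟩ := hv.2.2.1 m hm
    have h₁ := hv.nonneg hmuC
    have h₂ := (hu.1 v hv).2
    rw [map_add, hz] at h₁
    have h₃ : (-1 : ℝ) < z := by linarith
    -- Integrality turns the strict bound `v u < 1` into `0 ≤ v m`.
    have h₄ : -1 < z := by exact_mod_cast h₃
    rw [hz]
    exact_mod_cast (by omega : 0 ≤ z)
  suffices h : m ∈ faceLattice S ((monoidCone S).minFace m hmC) from
    hsemi.mem (PointedCone.minFace_isFaceOf hmC) h (PointedCone.isRelInterior_minFace hmC)
  by_contra hcon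
  have hfin : {D : PointedCone ℝ V | D.IsFaceOf (monoidCone S) ∧ m ∈ D ∧
      m ∉ faceLattice S D}.Finite := by
    refine Set.Finite.subset ?_ fun D hD ↦ hD.1
    rw [hG]
    exact PointedCone.finite_faces G.finite_toSet
  -- By maximality `m` lies in the lattices of all larger faces, so `m` itself witnesses that `D` is
  -- an RUF. Hence `u ∈ D`, and q m is the difference of q(u + m) and q u in M_D.
  obtain ⟨D, -, hD⟩ := hfin.exists_le_maximal
    ⟨PointedCone.minFace_isFaceOf hmC, PointedCone.self_mem_minFace hmC, hcon⟩
  obtain ⟨hDface, hmD, hmD'⟩ := hD.1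
  have hruf : IsRUF S D := by
    refine ⟨hDface, Or.inr (not_isRelSaturated_iff.2
      ⟨m, hmD', Submodule.subset_span hmD, fun D' hD' hlt ↦ ?_⟩)⟩
    by_contra hm'
    exact hlt.not_ge (hD.2 ⟨hD', hlt.le hmD, hm'⟩ hlt.le)
  have huD := mem_rufIntersection.1 hu.2 D hruf
  refine hmD' (hsemi.mem_faceLattice_of_nsmul_mem hfg hq (by rwa [hSM]) hDface (by rwa [hSM])
    (Submodule.subset_span hmD) ?_)
  have h₁ := mem_faceLattice hmu (nsmul_mem (D.add_mem huD hmD) q)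
  have h₂ := mem_faceLattice huS (nsmul_mem huD q)
  simpa [smul_add] using sub_mem h₁ h₂

theorem isSplitPoint_iff (hfg : S.FG) (hSM : Submodule.span ℤ (S : Set V) = M)
    (hsemi : IsSeminormalMonoid S) {p : ℕ} (hp : p.Prime)
    (hpS : ∀ e : ℕ, ∀ x ∈ M, p ^ e • x ∈ S → x ∈ S) {e : ℕ} {u : V} :
    IsSplitPoint M S (p ^ e) u ↔ u ∈ fractionalPoints S (p ^ e) ∩ splittingPolytope M S := by
  have hq : p ^ e ≠ 0 := pow_ne_zero e hp.ne_zero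
  refine ⟨fun hu ↦ ⟨hu.1, fun v hv ↦ ⟨hv.nonneg (hu.mem_cone hq), ?_⟩, ?_⟩, fun hu ↦ ?_⟩
  · exact hu.apply_lt_one hfg hSM hsemi hp hpS hv
  · exact hu.mem_rufIntersection hfg hSM hsemi hq
  · exact isSplitPoint_of_mem_splittingPolytope hfg hSM hsemi hq (hpS e) hu.1 hu.2

theorem isBounded_splittingPolytope (hfg : S.FG) (hSM : Submodule.span ℤ (S : Set V) = M)
    (hpointed : (monoidCone S : ConvexCone ℝ V).Salient) :
    Bornology.IsBounded (splittingPolytope M S) := by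
  obtain ⟨G, hGM, hGs, hG⟩ := exists_finset_generators M hfg hSM
  rw [hG] at hpointed
  refine (isBounded_forall_isPrimitiveRayGenerator M hGM hGs hpointed).subset ?_
  rw [← hG]
  exact Set.inter_subset_left

open scoped Pointwise in
theorem finite_fractionalPoints_inter (hfg : S.FG) (hSM : Submodule.span ℤ (S : Set V) = M)
    (hpointed : (monoidCone S : ConvexCone ℝ V).Salient) {q : ℕ} (hq : q ≠ 0) :
    (fractionalPoints S q ∩ splittingPolytope M S).Finite := by
  have hb := (isBounded_splittingPolytope hfg hSM hpointed).smul₀ (q : ℝ)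
  have hfin : ((q : ℝ) • splittingPolytope M S ∩ (M : Set V)).Finite :=
    Metric.finite_isBounded_inter_isClosed DiscreteTopology.isDiscrete hb
      (AddSubgroup.isClosed_of_discrete (H := M.toAddSubgroup))
  have hinj : Function.Injective fun x : V ↦ (q : ℝ) • x :=
    smul_right_injective V (by exact_mod_cast hq)
  refine (hfin.preimage hinj.injOn).subset fun x hx ↦ ⟨Set.smul_mem_smul_set hx.2, ?_⟩
  change (q : ℝ) • x ∈ M
  rw [Nat.cast_smul_eq_nsmul, ← hSM]
  exact Submodule.subset_span hx.1

end SplitPoints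

/-- The elements `s` for which `s + q • m ∈ S` implies `m ∈ S`, for `m ∈ M`. -/
def IsSplitElement {V : Type*} [AddCommGroup V] (M : Submodule ℤ V) (S : AddSubmonoid V)
    (q : ℕ) (s : V) : Prop :=
  ∀ m ∈ M, s + q • m ∈ S → m ∈ S

/-! ### The Frobenius root map attached to a split element -/

section MonomialRoot

variable {V : Type*} [AddCommGroup V] {S : AddSubmonoid V}
  (k : Type*) [Field k] (p e : ℕ) [Fact p.Prime] [CharP k p] [PerfectField k]

open Classical in
/-- The additive map of `k[S]` that sends `a x ^ (s + q w)` to `a ^ (1/q) x ^ w` and the other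
monomials to `0`, where `q = p ^ e`. -/
noncomputable def monomialRoot (s : S) : AddMonoidAlgebra k S →+ AddMonoidAlgebra k S :=
  (Finsupp.liftAddHom fun t : S ↦
    if h : ∃ w : S, t = s + p ^ e • w then
      (AddMonoidAlgebra.singleAddHom h.choose).comp
        ((iterateFrobeniusEquiv k p e).symm : k ≃+* k).toAddMonoidHom
    else 0).comp AddMonoidAlgebra.coeffAddEquiv.toAddMonoidHom

variable {k p e}

theorem monomialRoot_single_of_not {s t : S} (h : ¬ ∃ w : S, t = s + p ^ e • w) (a : k) :
    monomialRoot k p e s (AddMonoidAlgebra.single t a) = 0 := by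
  simp only [monomialRoot, AddMonoidHom.comp_apply]
  change Finsupp.liftAddHom _ (Finsupp.single _ a) = _
  rw [Finsupp.liftAddHom_apply_single, dif_neg h]
  rfl

variable [Module ℝ V]

theorem monomialRoot_single_add (s w : S) (a : k) :
    monomialRoot k p e s (AddMonoidAlgebra.single (s + p ^ e • w) a) =
      AddMonoidAlgebra.single w ((iterateFrobeniusEquiv k p e).symm a) := by
  have h : ∃ w' : S, s + p ^ e • w = s + p ^ e • w' := ⟨w, rfl⟩
  have hw : h.choose = w := by
    have h' := congrArg (Subtype.val : S → V) (add_left_cancel h.choose_spec)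
    rw [AddSubmonoidClass.coe_nsmul, AddSubmonoidClass.coe_nsmul, ← Nat.cast_smul_eq_nsmul ℝ,
      ← Nat.cast_smul_eq_nsmul ℝ] at h'
    have hp : ((p ^ e : ℕ) : ℝ) ≠ 0 := by
      have := (Fact.out : p.Prime).pos
      positivity
    exact Subtype.ext (smul_right_injective V hp h').symm
  simp only [monomialRoot, AddMonoidHom.comp_apply]
  change Finsupp.liftAddHom _ (Finsupp.single _ a) = _
  rw [Finsupp.liftAddHom_apply_single, dif_pos h, hw]
  rfl

theorem monomialRoot_pow_mul {M : Submodule ℤ V} (hSM : (S : Set V) ⊆ M) {s : S}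
    (hs : IsSplitElement M S (p ^ e) s) (r f : AddMonoidAlgebra k S) :
    monomialRoot k p e s (r ^ p ^ e * f) = r * monomialRoot k p e s f := by
  induction r using AddMonoidAlgebra.induction_linear with
  | zero => rw [zero_pow (pow_ne_zero e (Fact.out : p.Prime).ne_zero)]; simp
  | add r r' hr hr' => rw [add_pow_expChar_pow, add_mul, map_add, hr, hr', add_mul]
  | single w b =>
    induction f using AddMonoidAlgebra.induction_linear with
    | zero => simp
    | add f f' hf hf' => rw [mul_add, map_add, map_add, hf, hf', mul_add]
    | single t a =>
      rw [AddMonoidAlgebra.single_pow, AddMonoidAlgebra.single_mul_single]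
      by_cases h : ∃ w' : S, t = s + p ^ e • w'
      · obtain ⟨w', rfl⟩ := h
        rw [monomialRoot_single_add, show p ^ e • w + (s + p ^ e • w') = s + p ^ e • (w + w') by
          rw [smul_add]; abel, monomialRoot_single_add, AddMonoidAlgebra.single_mul_single, map_mul]
        congr 2
        exact (iterateFrobeniusEquiv k p e).symm_apply_apply b
      · rw [monomialRoot_single_of_not h, mul_zero, monomialRoot_single_of_not]
        rintro ⟨w', hw'⟩
        have hw' : p ^ e • (w : V) + t = s + p ^ e • (w' : V) := congrArg Subtype.val hw'
        have ht : (s : V) + p ^ e • ((w' : V) - w) = t := by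
          rw [smul_sub, ← add_sub_assoc, ← hw']; abel
        -- Splitness of `s` ensures that a monomial killed by the map stays killed after
        -- multiplication by a q-th power.
        have hmem := hs (w' - w) (sub_mem (hSM w'.2) (hSM w.2)) (by rw [ht]; exact t.2)
        exact h ⟨⟨_, hmem⟩, Subtype.ext ht.symm⟩

variable (k p e) in
/-- The `k[S]`-linear map `F^e_* k[S] → k[S]` given by `monomialRoot`. -/
noncomputable def monomialRootHom {M : Submodule ℤ V} (hSM : (S : Set V) ⊆ M) {s : S}
    (hs : IsSplitElement M S (p ^ e) s) :
    FrobPush (AddMonoidAlgebra k S) p e →ₗ[AddMonoidAlgebra k S] AddMonoidAlgebra k S where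
  toFun f := monomialRoot k p e s ((FrobPush.of _ p e).symm f)
  map_add' _ _ := map_add (monomialRoot k p e s) _ _
  map_smul' r _ := monomialRoot_pow_mul hSM hs r _

theorem monomialRootHom_of {M : Submodule ℤ V} (hSM : (S : Set V) ⊆ M) {s : S}
    (hs : IsSplitElement M S (p ^ e) s) (f : AddMonoidAlgebra k S) :
    monomialRootHom k p e hSM hs (FrobPush.of _ p e f) = monomialRoot k p e s f := rfl

/-- Only the monomial at `s` contributes to the constant term, so this map detects the coefficient
of `f` at `s`. -/
theorem coeff_zero_monomialRoot (s : S) (f : AddMonoidAlgebra k S) :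
    (monomialRoot k p e s f).coeff 0 = (iterateFrobeniusEquiv k p e).symm (f.coeff s) := by
  classical
  induction f using AddMonoidAlgebra.induction_linear with
  | zero => simp
  | add f g hf hg => simp [hf, hg]
  | single t a =>
    by_cases h : ∃ w : S, t = s + p ^ e • w
    · obtain ⟨w, rfl⟩ := h
      rw [monomialRoot_single_add, AddMonoidAlgebra.coeff_single, AddMonoidAlgebra.coeff_single,
        Finsupp.single_apply, Finsupp.single_apply, apply_ite (iterateFrobeniusEquiv k p e).symm,
        map_zero]
      refine if_congr ?_ rfl rfl
      rw [add_eq_left]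
      refine ⟨fun h ↦ by rw [h, smul_zero], fun h ↦ ?_⟩
      have h := congrArg (Subtype.val : S → V) h
      rw [AddSubmonoidClass.coe_nsmul, ← Nat.cast_smul_eq_nsmul ℝ, AddSubmonoid.coe_zero,
        smul_eq_zero] at h
      have := (Fact.out : p.Prime).pos
      exact Subtype.ext (h.resolve_left (by positivity))
    · rw [monomialRoot_single_of_not h, AddMonoidAlgebra.coeff_single, Finsupp.single_eq_of_ne]
      · simp
      · rintro rfl
        exact h ⟨0, by simp⟩

end MonomialRoot

/-! ### Split elements from constant coefficients -/

section SplitElements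

variable {V : Type*} [AddCommGroup V] {S : AddSubmonoid V}

theorem exists_sub_eq_of_mem_span_int {m : V} (hm : m ∈ Submodule.span ℤ (S : Set V)) :
    ∃ w w' : S, m = w - w' := by
  induction hm using Submodule.span_induction with
  | mem x hx => exact ⟨⟨x, hx⟩, 0, by simp⟩
  | zero => exact ⟨0, 0, by simp⟩
  | add x y _ _ hx hy =>
    obtain ⟨w, w', rfl⟩ := hx
    obtain ⟨z, z', rfl⟩ := hy
    exact ⟨w + z, w' + z', by push_cast; abel⟩
  | smul a x _ hx =>
    obtain ⟨w, w', rfl⟩ := hx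
    obtain ⟨n, rfl | rfl⟩ := a.eq_nat_or_neg
    · exact ⟨n • w, n • w', by simp [smul_sub]⟩
    · exact ⟨n • w', n • w, by simp [sub_eq_add_neg, add_comm]⟩

variable {k : Type*} [Field k]

theorem mem_monomialIdeal_iff {T : Set S} (hT : ∀ t ∈ T, ∀ d, d + t ∈ T)
    {f : AddMonoidAlgebra k S} : f ∈ monomialIdeal k T ↔ ∀ s, f.coeff s ≠ 0 → s ∈ T := by
  refine AddMonoidAlgebra.mem_ideal_span_of'_image.trans ?_
  simp only [Finsupp.mem_support_iff]
  refine forall₂_congr fun s _ ↦ ⟨?_, fun hs ↦ ⟨s, hs, 0, by simp⟩⟩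
  rintro ⟨t, ht, d, rfl⟩
  exact hT t ht d

theorem mem_monomialIdeal_ne_zero_iff (hS : ∀ m : V, m ∈ S → -m ∈ S → m = 0)
    {f : AddMonoidAlgebra k S} : f ∈ monomialIdeal k {u : S | u ≠ 0} ↔ f.coeff 0 = 0 := by
  rw [mem_monomialIdeal_iff]
  · refine ⟨fun h ↦ ?_, fun h s hs h0 ↦ hs (h0 ▸ h)⟩
    by_contra h0
    exact h 0 h0 rfl
  · intro t ht d h0
    have h0 : (d : V) + t = 0 := congrArg Subtype.val h0
    refine ht (Subtype.ext (hS t t.2 ?_))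
    rw [← eq_neg_of_add_eq_zero_left h0]
    exact d.2

variable {p : ℕ} [Fact p.Prime] [CharP k p] {e : ℕ}

/-- Write m = w - w' and t = s + q m. Then q w + s = q w' + t, so linearity gives x^w φ(a x^s) =
x^{w'} φ(a x^t). The left side has a nonzero coefficient at w, hence w ∈ w' + S, that is, m ∈ S. -/
theorem isSplitElement_of_coeff_zero_ne_zero
    (φ : FrobPush (AddMonoidAlgebra k S) p e →ₗ[AddMonoidAlgebra k S] AddMonoidAlgebra k S)
    (s : S) (a : k)
    (h : (φ (FrobPush.of _ p e (AddMonoidAlgebra.single s a))).coeff 0 ≠ 0) :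
    IsSplitElement (Submodule.span ℤ (S : Set V)) S (p ^ e) s := by
  intro m hm hmS
  obtain ⟨w, w', rfl⟩ := exists_sub_eq_of_mem_span_int hm
  have key (w t : S) : φ (FrobPush.of _ p e (AddMonoidAlgebra.single (p ^ e • w + t) a)) =
      AddMonoidAlgebra.single w 1 * φ (FrobPush.of _ p e (AddMonoidAlgebra.single t a)) := by
    rw [← smul_eq_mul, ← map_smul, FrobPush.smul_of, AddMonoidAlgebra.single_pow,
      AddMonoidAlgebra.single_mul_single, one_pow, one_mul]
  let t : S := ⟨_, hmS⟩
  have ht : p ^ e • w + s = p ^ e • w' + t := by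
    refine Subtype.ext ?_
    simp only [t, AddSubmonoid.coe_add, AddSubmonoidClass.coe_nsmul, smul_sub]
    abel
  have h₁ := key w s
  rw [ht, key w' t] at h₁
  have h₂ := AddMonoidAlgebra.coeff_single_mul_add
    (φ (FrobPush.of _ p e (AddMonoidAlgebra.single s a))) 1 w 0
  rw [← h₁, one_mul, add_zero] at h₂
  by_cases hex : ∃ d : S, w' + d = w
  · obtain ⟨d, rfl⟩ := hex
    simp
  · rw [AddMonoidAlgebra.coeff_single_mul_of_forall_add_ne _ _ (not_exists.1 hex)] at h₂
    exact absurd h₂.symm h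

theorem coeff_zero_eq_zero_of_forall_not_isSplitElement
    (φ : FrobPush (AddMonoidAlgebra k S) p e →ₗ[AddMonoidAlgebra k S] AddMonoidAlgebra k S)
    {f : AddMonoidAlgebra k S} (hf : ∀ s : S, f.coeff s ≠ 0 →
      ¬ IsSplitElement (Submodule.span ℤ (S : Set V)) S (p ^ e) s) :
    (φ (FrobPush.of _ p e f)).coeff 0 = 0 := by
  rw [← AddMonoidAlgebra.sum_coeff_single f, Finsupp.sum, map_sum, map_sum,
    AddMonoidAlgebra.coeff_sum, Finsupp.finsetSum_apply]
  refine Finset.sum_eq_zero fun s hs ↦ ?_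
  by_contra h
  exact hf s (Finsupp.mem_support_iff.1 hs) (isSplitElement_of_coeff_zero_ne_zero φ s _ h)

/-- The splitting sends 1 to 1, so 0 is a split element for q = p. This allows division by p, one
factor at a time. -/
theorem mem_of_isFSplit (hsplit : IsFSplit (AddMonoidAlgebra k S) p) (e : ℕ) {x : V}
    (hx : x ∈ Submodule.span ℤ (S : Set V)) (hpx : p ^ e • x ∈ S) : x ∈ S := by
  obtain ⟨π, hπ⟩ := hsplit
  have h0 : IsSplitElement (Submodule.span ℤ (S : Set V)) S (p ^ 1) (0 : S) := by
    refine isSplitElement_of_coeff_zero_ne_zero π 0 (1 : k) ?_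
    have := hπ 1
    rw [map_one] at this
    rw [← AddMonoidAlgebra.one_def, this, AddMonoidAlgebra.one_def]
    simp
  induction e with
  | zero => simpa using hpx
  | succ e ih =>
    refine ih (h0 _ (nsmul_mem hx _) ?_)
    rw [pow_one, smul_smul, ← pow_succ']
    simpa using hpx

end SplitElements

/-! ### Splitting numbers and the splitting prime -/

section SplittingNumbers

variable {V : Type*} [AddCommGroup V] {S : AddSubmonoid V}
  {k : Type*} [Field k] {p : ℕ} [Fact p.Prime] [CharP k p] [PerfectField k] {e : ℕ}

/-- The coefficient vectors at `B` of the n basis images are linearly independent over k. Given a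
relation with coefficients g_l, the combination of the images has no split monomial, so its image
under π, the vector of q-th roots of the g_l, has zero constant terms. -/
theorem HasFreeSummand.le_card {n : ℕ} (h : HasFreeSummand (AddMonoidAlgebra k S) p e n)
    (B : Finset S)
    (hB : ∀ s : S, IsSplitElement (Submodule.span ℤ (S : Set V)) S (p ^ e) s → s ∈ B) :
    n ≤ B.card := by
  classical
  obtain ⟨i, π, hπ⟩ := h
  let x (l : Fin n) : AddMonoidAlgebra k S := (FrobPush.of _ p e).symm (i (Pi.single l 1))
  have hx (l : Fin n) : i (Pi.single l 1) = FrobPush.of _ p e (x l) := rfl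
  have hli : LinearIndependent k fun (l : Fin n) (s : B) ↦ (x l).coeff (s : S) := by
    refine Fintype.linearIndependent_iff.2 fun g hg j ↦ ?_
    -- The q-th root appears because scalars act on F^e_* R through their q-th powers.
    let c (l : Fin n) : AddMonoidAlgebra k S :=
      AddMonoidAlgebra.single 0 ((iterateFrobeniusEquiv k p e).symm (g l))
    have hc (l : Fin n) : c l ^ p ^ e = AddMonoidAlgebra.single 0 (g l) := by
      rw [AddMonoidAlgebra.single_pow, smul_zero]
      congr 1
      exact (iterateFrobeniusEquiv k p e).apply_symm_apply (g l)
    have hic : i c = FrobPush.of _ p e (∑ l, AddMonoidAlgebra.single 0 (g l) * x l) := by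
      rw [pi_eq_sum_univ' c, map_sum, map_sum]
      refine Finset.sum_congr rfl fun l _ ↦ ?_
      rw [← hc, ← FrobPush.smul_of, ← hx, ← map_smul]
    have h0 := coeff_zero_eq_zero_of_forall_not_isSplitElement ((LinearMap.proj j).comp π)
      (f := ∑ l, AddMonoidAlgebra.single 0 (g l) * x l) (fun s hs hsplit ↦ hs (by
        have := congrFun hg ⟨s, hB s hsplit⟩
        simp only [Finset.sum_apply, Pi.smul_apply, Pi.zero_apply, smul_eq_mul] at this
        rw [AddMonoidAlgebra.coeff_sum, Finsupp.finsetSum_apply, ← this]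
        refine Finset.sum_congr rfl fun l _ ↦ ?_
        have := AddMonoidAlgebra.coeff_single_mul_add (x l) (g l) 0 s
        rwa [zero_add] at this))
    rw [← hic, LinearMap.comp_apply] at h0
    have : π (i c) = c := LinearMap.congr_fun hπ c
    rw [this] at h0
    simpa [c] using h0
  have := hli.fintype_card_le_finrank
  simpa using this

variable [Module ℝ V]

theorem hasFreeSummand_of_injective (hS : ∀ m : V, m ∈ S → -m ∈ S → m = 0) {n : ℕ} {s : Fin n → S}
    (hinj : Function.Injective s)
    (hs : ∀ i, IsSplitElement (Submodule.span ℤ (S : Set V)) S (p ^ e) (s i)) :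
    HasFreeSummand (AddMonoidAlgebra k S) p e n := by
  classical
  refine ⟨Fintype.linearCombination (AddMonoidAlgebra k S)
      (fun j ↦ FrobPush.of _ p e (AddMonoidAlgebra.single (s j) 1)),
    LinearMap.pi fun i ↦ monomialRootHom k p e Submodule.subset_span (hs i), ?_⟩
  refine LinearMap.pi_ext' fun j ↦ LinearMap.ext_ring (funext fun i ↦ ?_)
  simp only [LinearMap.comp_apply, LinearMap.single_apply, LinearMap.pi_apply, LinearMap.id_apply,
    Fintype.linearCombination_apply_single, one_smul, monomialRootHom_of]
  rcases eq_or_ne i j with rfl | hij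
  · have := monomialRoot_single_add (p := p) (e := e) (s i) 0 (1 : k)
    rw [smul_zero, add_zero] at this
    rw [this, map_one, Pi.single_eq_same, AddMonoidAlgebra.one_def]
  · rw [Pi.single_eq_of_ne hij]
    refine monomialRoot_single_of_not (fun ⟨w, hw⟩ ↦ hij (hinj ?_)) 1
    have hw' : (s j : V) = s i + p ^ e • (w : V) := congrArg Subtype.val hw
    -- Off the diagonal the root map must vanish: if s_j = s_i + q w, splitness of s_j gives -w ∈ S,
    -- so w = 0.
    have hneg := hs j (-w) (neg_mem (Submodule.subset_span w.2)) (by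
      rw [hw', smul_neg, add_neg_cancel_right]; exact (s i).2)
    have hw0 : w = 0 := Subtype.ext (hS w w.2 hneg)
    rw [hw, hw0, smul_zero, add_zero]

theorem fSplittingNumber_eq_encard (hS : ∀ m : V, m ∈ S → -m ∈ S → m = 0)
    (hfin : {s : S | IsSplitElement (Submodule.span ℤ (S : Set V)) S (p ^ e) s}.Finite) :
    fSplittingNumber (AddMonoidAlgebra k S) p e =
      {s : S | IsSplitElement (Submodule.span ℤ (S : Set V)) S (p ^ e) s}.encard := by
  obtain ⟨B, hB⟩ := hfin.exists_finset_coe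
  have hB' (s : S) : s ∈ B ↔ IsSplitElement (Submodule.span ℤ (S : Set V)) S (p ^ e) s := by
    rw [← Finset.mem_coe, hB]; rfl
  rw [← hB, Set.encard_coe_eq_coe_finsetCard]
  refine le_antisymm (iSup₂_le fun n hn ↦ ?_) ?_
  · exact_mod_cast hn.le_card B fun s hs ↦ (hB' s).2 hs
  · exact le_iSup₂_of_le B.card (hasFreeSummand_of_injective hS
      (Subtype.val_injective.comp B.equivFin.symm.injective)
      fun i ↦ (hB' _).1 (B.equivFin.symm i).2) le_rfl

theorem fSplittingPrime_eq_monomialIdeal (hS : ∀ m : V, m ∈ S → -m ∈ S → m = 0) {T : Set S}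
    (hT : ∀ t ∈ T, ∀ d, d + t ∈ T)
    (hTs : ∀ s ∈ T, ∀ e, ¬ IsSplitElement (Submodule.span ℤ (S : Set V)) S (p ^ e) s)
    (hsT : ∀ s ∉ T, ∃ e, 0 < e ∧ IsSplitElement (Submodule.span ℤ (S : Set V)) S (p ^ e) s) :
    fSplittingPrime (AddMonoidAlgebra k S) p (monomialIdeal k {u : S | u ≠ 0}) =
      monomialIdeal k T := by
  classical
  refine le_antisymm (Ideal.span_le.2 fun f hf ↦ ?_) (Ideal.span_le.2 ?_)
  · refine (mem_monomialIdeal_iff hT).2 fun s hs ↦ ?_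
    by_contra hsn
    obtain ⟨e, he, hse⟩ := hsT s hsn
    have := (mem_monomialIdeal_ne_zero_iff hS).1
      (hf e he (monomialRootHom k p e Submodule.subset_span hse))
    rw [monomialRootHom_of, coeff_zero_monomialRoot] at this
    exact hs (by simpa using this)
  · rintro _ ⟨u, hu, rfl⟩
    refine Ideal.subset_span fun e he φ ↦ (mem_monomialIdeal_ne_zero_iff hS).2
      (coeff_zero_eq_zero_of_forall_not_isSplitElement φ fun s hs ↦ ?_)
    have : u = s := by
      by_contra hne
      exact hs (by simp [hne])
    exact this ▸ hTs u hu e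

end SplittingNumbers

/-! ### Lattice point counts and volume -/

section Counting

variable {ι : Type*} [Fintype ι]

/-- The points of `ℝ ^ ι` with coordinates in `(1/q) ℤ`. -/
def rationalGrid (ι : Type*) (q : ℕ) : Set (ι → ℝ) := {c | ∀ i, ∃ n : ℤ, (q : ℝ) * c i = n}

open scoped Pointwise in
theorem rationalGrid_eq {q : ℕ} (hq : q ≠ 0) : rationalGrid ι q =
    (q : ℝ)⁻¹ • (Submodule.span ℤ (Set.range (Pi.basisFun ℝ ι)) : Set (ι → ℝ)) := by
  ext c
  have hq' : (q : ℝ) ≠ 0 := by exact_mod_cast hq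
  rw [Set.mem_smul_set_iff_inv_smul_mem₀ (inv_ne_zero hq'), inv_inv, SetLike.mem_coe,
    Module.Basis.mem_span_iff_repr_mem]
  refine forall_congr' fun i ↦ ?_
  simp [eq_comm]

open scoped Pointwise in
theorem finite_inter_rationalGrid {q : ℕ} (hq : q ≠ 0) {P : Set (ι → ℝ)}
    (hP : Bornology.IsBounded P) : (P ∩ rationalGrid ι q).Finite := by
  have hq' : (q : ℝ) ≠ 0 := by exact_mod_cast hq
  have hfin := ZSpan.setFinite_inter (Pi.basisFun ℝ ι) (hP.smul₀ (q : ℝ))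
  refine (hfin.preimage (smul_right_injective (ι → ℝ) hq').injOn).subset ?_
  rintro c ⟨hc, hcq⟩
  refine ⟨Set.smul_mem_smul_set hc, ?_⟩
  rwa [rationalGrid_eq hq, Set.mem_smul_set_iff_inv_smul_mem₀ (inv_ne_zero hq'), inv_inv] at hcq

theorem tendsto_ncard_inter_rationalGrid {P : Set (ι → ℝ)} (hP : Bornology.IsBounded P)
    (hm : MeasurableSet P) (h0 : volume (frontier P) = 0) :
    Tendsto (fun q : ℕ ↦ ((P ∩ rationalGrid ι q).ncard : ℝ) / (q : ℝ) ^ Fintype.card ι) atTop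
      (𝓝 (volume.real P)) := by
  refine (tendsto_card_div_pow_atTop_volume P hP hm h0).congr' ?_
  filter_upwards [eventually_ne_atTop 0] with q hq
  rw [← rationalGrid_eq hq, Nat.card_coe_set_eq]

/-- A counting function squeezed between the numbers of points with coordinates in `(1/q) ℤ` in the
interior and in the closure of a bounded convex set grows like its volume. -/
theorem tendsto_div_pow_of_convex {P : Set (ι → ℝ)} (hP : Bornology.IsBounded P)
    (hconv : Convex ℝ P) {F : ℕ → ℕ}
    (hlow : ∀ q, q ≠ 0 → (interior P ∩ rationalGrid ι q).ncard ≤ F q)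
    (hupp : ∀ q, q ≠ 0 → F q ≤ (closure P ∩ rationalGrid ι q).ncard) {u : ℕ → ℕ}
    (hu : Tendsto u atTop atTop) (hu0 : ∀ n, u n ≠ 0) :
    Tendsto (fun n : ℕ ↦ (F (u n) : ℝ) / (u n : ℝ) ^ Fintype.card ι) atTop
      (𝓝 (volume.real P)) := by
  have h0 := hconv.addHaar_frontier volume
  have h₁ := tendsto_ncard_inter_rationalGrid (hP.subset interior_subset)
    isOpen_interior.measurableSet (measure_mono_null frontier_interior_subset h0)
  have h₂ := tendsto_ncard_inter_rationalGrid hP.closure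
    isClosed_closure.measurableSet (measure_mono_null frontier_closure_subset h0)
  rw [measureReal_congr (interior_ae_eq_of_null_frontier h0)] at h₁
  rw [measureReal_congr (closure_ae_eq_of_null_frontier h0)] at h₂
  refine tendsto_of_tendsto_of_tendsto_of_le_of_le (h₁.comp hu) (h₂.comp hu) ?_ ?_
  · intro n
    have := hlow (u n) (hu0 n)
    simp only [Function.comp_apply]
    gcongr
  · intro n
    have := hupp (u n) (hu0 n)
    simp only [Function.comp_apply]
    gcongr

end Counting

/-! ### The splitting polytope in lattice coordinates -/

section Volume

variable {V : Type*} [NormedAddCommGroup V] [NormedSpace ℝ V]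
  {M : Submodule ℤ V} {S : AddSubmonoid V} {D : PointedCone ℝ V}

theorem discreteTopology_faceLattice [DiscreteTopology M]
    (hSM : Submodule.span ℤ (S : Set V) = M) :
    DiscreteTopology (faceLattice S D) := by
  have hle : (faceLattice S D : Set V) ⊆ M := by rw [← hSM]; exact faceLattice_le
  exact DiscreteTopology.of_subset (s := (M : Set V)) ‹_› hle

theorem span_range_basis_faceLattice {ι : Type*} (hD : D.IsFaceOf (monoidCone S))
    (b : Basis ι ℤ (faceLattice S D)) :
    Submodule.span ℝ (Set.range fun i ↦ (b i : V)) = Submodule.span ℝ (D : Set V) := by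
  refine le_antisymm (Submodule.span_le.2 ?_) ?_
  · rintro _ ⟨i, rfl⟩
    exact faceLattice_le_span (b i).2
  · rw [← hD.span_inter, Submodule.span_le]
    rintro x ⟨hx, hxD⟩
    have h : (⟨x, mem_faceLattice hx hxD⟩ : faceLattice S D) ∈ Submodule.span ℤ (Set.range b) := by
      rw [b.span_eq]; trivial
    have h' := Submodule.mem_map_of_mem (f := (faceLattice S D).subtype) h
    rw [Submodule.map_span, ← Set.range_comp] at h'
    exact Submodule.span_le_restrictScalars ℤ ℝ _ h'

theorem convex_splittingPolytope (M : Submodule ℤ V) : Convex ℝ (splittingPolytope M S) := by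
  refine Convex.inter ?_ (rufIntersection S).convex
  have : saturationPolytope M S = ⋂ v ∈ {v | IsPrimitiveRayGenerator M (monoidCone S) v},
      (v ⁻¹' Set.Ico (0 : ℝ) 1) := by
    ext x; simp [saturationPolytope]
  rw [this]
  exact convex_iInter₂ fun v _ ↦ (convex_Ico 0 1).linear_preimage v

variable {ι : Type*} [Fintype ι] (b : Basis ι ℤ (faceLattice S (rufIntersection S)))

/-- The splitting polytope in the coordinates of a basis of `M_{D_S}`. -/
def coordPolytope (M : Submodule ℤ V) (S : AddSubmonoid V)
    (b : Basis ι ℤ (faceLattice S (rufIntersection S))) : Set (ι → ℝ) :=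
  Fintype.linearCombination ℝ (fun i ↦ (b i : V)) ⁻¹' splittingPolytope M S

theorem mem_span_range_linearCombination (c : ι → ℝ) :
    Fintype.linearCombination ℝ (fun i ↦ (b i : V)) c ∈
      Submodule.span ℝ (rufIntersection S : Set V) := by
  rw [← span_range_basis_faceLattice rufIntersection_isFaceOf b,
    ← Fintype.range_linearCombination ℝ]
  exact ⟨c, rfl⟩

theorem exists_linearCombination_eq {x : V}
    (hx : x ∈ Submodule.span ℝ (rufIntersection S : Set V)) :
    ∃ c, Fintype.linearCombination ℝ (fun i ↦ (b i : V)) c = x := by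
  rw [← span_range_basis_faceLattice rufIntersection_isFaceOf b,
    ← Fintype.range_linearCombination ℝ] at hx
  exact hx

theorem isRelInterior_of_mem_interior_coordPolytope {c : ι → ℝ}
    (hc : c ∈ interior (coordPolytope M S b)) :
    (rufIntersection S).IsRelInterior (Fintype.linearCombination ℝ (fun i ↦ (b i : V)) c) := by
  refine ⟨(interior_subset hc).2, fun y hy ↦ ?_⟩
  obtain ⟨d, rfl⟩ := exists_linearCombination_eq b (Submodule.subset_span hy)
  have hcont : Continuous fun ε : ℝ ↦ c - ε • d := by fun_prop
  have ht := hcont.tendsto 0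
  rw [zero_smul, sub_zero] at ht
  obtain ⟨ε, hε, hε0⟩ := (((tendsto_nhdsWithin_of_tendsto_nhds (s := Set.Ioi 0) ht).eventually_mem
    (mem_interior_iff_mem_nhds.1 hc)).and self_mem_nhdsWithin).exists
  refine ⟨ε, hε0, ?_⟩
  rw [← map_smul, ← map_sub]
  exact hε.2

/-- A convex set has interior once its affine span is everything. Each direction y is a difference
of the cone points y + N c and N c, and small common multiples of both lie in the polytope. -/
theorem interior_coordPolytope_nonempty [DiscreteTopology M] [IsZLattice ℝ M]
    (hfg : S.FG) (hSM : Submodule.span ℤ (S : Set V) = M) :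
    (interior (coordPolytope M S b)).Nonempty := by
  have hconv : Convex ℝ (coordPolytope M S b) := (convex_splittingPolytope M).linear_preimage _
  have hev {y : ι → ℝ} (hy : Fintype.linearCombination ℝ (fun i ↦ (b i : V)) y ∈
      rufIntersection S) : ∀ᶠ t : ℝ in 𝓝[>] 0, t • y ∈ coordPolytope M S b := by
    filter_upwards [eventually_smul_mem_splittingPolytope hfg hSM hy] with t ht
    rwa [coordPolytope, Set.mem_preimage, map_smul]
  obtain ⟨s, -, hs⟩ := rufIntersection_isFaceOf.exists_isRelInterior hfg
  obtain ⟨c, hc⟩ := exists_linearCombination_eq b (Submodule.subset_span hs.1)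
  obtain ⟨t, ht⟩ := (hev (hc ▸ hs.1)).exists
  rw [hconv.interior_nonempty_iff_affineSpan_eq_top,
    AffineSubspace.affineSpan_eq_top_iff_vectorSpan_eq_top_of_nonempty ℝ _ _ ⟨_, ht⟩, eq_top_iff]
  intro y _
  obtain ⟨N, hN, -⟩ := hs.exists_add_smul_mem (mem_span_range_linearCombination b y)
  have h₁ := hev (y := y + (N : ℝ) • c) (by rwa [map_add, map_smul, hc])
  have h₂ := hev (y := (N : ℝ) • c) (by
    rw [map_smul, hc]; exact PointedCone.smul_mem _ N.cast_nonneg hs.1)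
  obtain ⟨r, ⟨hr₁, hr₂⟩, hr⟩ := ((h₁.and h₂).and self_mem_nhdsWithin).exists
  have hr : 0 < r := hr
  have := Submodule.smul_mem _ r⁻¹ (vsub_mem_vectorSpan ℝ hr₁ hr₂)
  rwa [vsub_eq_sub, ← smul_sub, add_sub_cancel_right, inv_smul_smul₀ hr.ne'] at this

variable [FiniteDimensional ℝ V] [DiscreteTopology M]

theorem finrank_faceLattice (hSM : Submodule.span ℤ (S : Set V) = M)
    (hD : D.IsFaceOf (monoidCone S)) :
    finrank ℤ (faceLattice S D) = finrank ℝ (Submodule.span ℝ (D : Set V)) := by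
  have := discreteTopology_faceLattice (D := D) hSM
  have h := Real.finrank_eq_int_finrank_of_discrete (s := (S : Set V) ∩ D) this
  rw [Set.finrank, Set.finrank, hD.span_inter] at h
  exact h.symm

theorem linearIndependent_basis_faceLattice (hSM : Submodule.span ℤ (S : Set V) = M)
    (hD : D.IsFaceOf (monoidCone S)) (b : Basis ι ℤ (faceLattice S D)) :
    LinearIndependent ℝ fun i ↦ (b i : V) := by
  rw [linearIndependent_iff_card_eq_finrank_span, Set.finrank, span_range_basis_faceLattice hD b,
    ← finrank_faceLattice hSM hD, finrank_eq_card_basis b]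

variable [IsZLattice ℝ M]

theorem isBounded_coordPolytope (hfg : S.FG) (hSM : Submodule.span ℤ (S : Set V) = M)
    (hpointed : (monoidCone S : ConvexCone ℝ V).Salient) :
    Bornology.IsBounded (coordPolytope M S b) := by
  have hinj := (linearIndependent_basis_faceLattice hSM
    rufIntersection_isFaceOf b).fintypeLinearCombination_injective
  obtain ⟨K, -, hK⟩ := LinearMap.exists_antilipschitzWith _ (LinearMap.ker_eq_bot.2 hinj)
  exact hK.isBounded_preimage (isBounded_splittingPolytope hfg hSM hpointed)

/-- An interior grid point, multiplied by q, is a point of M_{D_S} in the relative interior of D_S,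
hence in `S` by seminormality. On the boundary this can fail. -/
theorem ncard_interior_le (hfg : S.FG) (hSM : Submodule.span ℤ (S : Set V) = M)
    (hpointed : (monoidCone S : ConvexCone ℝ V).Salient) (hsemi : IsSeminormalMonoid S)
    {q : ℕ} (hq : q ≠ 0) : (interior (coordPolytope M S b) ∩ rationalGrid ι q).ncard ≤
      (fractionalPoints S q ∩ splittingPolytope M S).ncard := by
  have hinj := (linearIndependent_basis_faceLattice hSM
    rufIntersection_isFaceOf b).fintypeLinearCombination_injective
  rw [← Set.ncard_image_of_injective _ hinj]
  refine Set.ncard_le_ncard ?_ (finite_fractionalPoints_inter hfg hSM hpointed hq)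
  rintro _ ⟨c, ⟨hc, hcq⟩, rfl⟩
  refine ⟨?_, interior_subset (s := coordPolytope M S b) hc⟩
  have hrel := (isRelInterior_of_mem_interior_coordPolytope b hc).smul
    (c := (q : ℝ)) (by positivity)
  rw [Nat.cast_smul_eq_nsmul] at hrel
  refine hsemi.mem rufIntersection_isFaceOf ?_ hrel
  choose n hn using hcq
  have : q • Fintype.linearCombination ℝ (fun i ↦ (b i : V)) c = ∑ i, n i • (b i : V) := by
    rw [← Nat.cast_smul_eq_nsmul ℝ, ← map_smul, Fintype.linearCombination_apply]
    refine Finset.sum_congr rfl fun i _ ↦ ?_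
    rw [Pi.smul_apply, smul_eq_mul, hn, Int.cast_smul_eq_zsmul]
  rw [this]
  exact sum_mem fun i _ ↦ zsmul_mem (b i).2 (n i)

/-- For this bound S ∩ D_S ⊆ M_{D_S} suffices. -/
theorem ncard_le_closure (hfg : S.FG) (hSM : Submodule.span ℤ (S : Set V) = M)
    (hpointed : (monoidCone S : ConvexCone ℝ V).Salient)
    {q : ℕ} (hq : q ≠ 0) : (fractionalPoints S q ∩ splittingPolytope M S).ncard ≤
      (closure (coordPolytope M S b) ∩ rationalGrid ι q).ncard := by
  have hinj := (linearIndependent_basis_faceLattice hSM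
    rufIntersection_isFaceOf b).fintypeLinearCombination_injective
  have hfin := finite_inter_rationalGrid hq (isBounded_coordPolytope b hfg hSM hpointed).closure
  have hq' : (q : ℝ) ≠ 0 := by exact_mod_cast hq
  rw [← Set.ncard_image_of_injective _ hinj]
  refine Set.ncard_le_ncard ?_ (hfin.image _)
  rintro x ⟨hxS, hx⟩
  have hqx : q • x ∈ faceLattice S (rufIntersection S) :=
    mem_faceLattice hxS (nsmul_mem hx.2 q)
  have hrepr := congrArg (Subtype.val : faceLattice S (rufIntersection S) → V)
    (b.sum_repr ⟨_, hqx⟩)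
  have hc : Fintype.linearCombination ℝ (fun i ↦ (b i : V))
      (fun i ↦ (q : ℝ)⁻¹ * (b.repr ⟨_, hqx⟩ i : ℝ)) = x := by
    have h : q • x = ∑ i, b.repr ⟨_, hqx⟩ i • (b i : V) :=
      hrepr.symm.trans (map_sum (Submodule.subtype _) _ _)
    rw [Fintype.linearCombination_apply]
    simp_rw [mul_smul, Int.cast_smul_eq_zsmul]
    rw [← Finset.smul_sum, ← h, ← Nat.cast_smul_eq_nsmul ℝ, inv_smul_smul₀ hq']
  refine ⟨_, ⟨subset_closure ?_, fun i ↦ ⟨b.repr ⟨_, hqx⟩ i, mul_inv_cancel_left₀ hq' _⟩⟩, hc⟩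
  rwa [coordPolytope, Set.mem_preimage, hc]

theorem hasFSplittingDimRatio_of_ncard {R : Type*} [CommRing R] {p : ℕ} [ExpChar R p]
    (hp : 1 < p) (hfg : S.FG) (hSM : Submodule.span ℤ (S : Set V) = M)
    (hpointed : (monoidCone S : ConvexCone ℝ V).Salient) (hsemi : IsSeminormalMonoid S)
    (h : ∀ e : ℕ, fSplittingNumber R p e =
      (fractionalPoints S (p ^ e) ∩ splittingPolytope M S).encard) :
    HasFSplittingDimRatio R p (finrank ℝ (Submodule.span ℝ (rufIntersection S : Set V)))
      (latticeVolume (faceLattice S (rufIntersection S)) (splittingPolytope M S)) := by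
  have := discreteTopology_faceLattice (D := rufIntersection S) hSM
  have hne : Nonempty (Basis (Fin (finrank ℤ (faceLattice S (rufIntersection S)))) ℤ
      (faceLattice S (rufIntersection S))) := ⟨Module.finBasis ℤ _⟩
  rw [latticeVolume, dif_pos hne, ← finrank_faceLattice hSM rufIntersection_isFaceOf]
  generalize hne.some = b
  change HasFSplittingDimRatio R p _ (volume (coordPolytope M S b))
  have hb := isBounded_coordPolytope b hfg hSM hpointed
  have hlt := hb.measure_lt_top (μ := volume)
  have hq (e : ℕ) : p ^ e ≠ 0 := pow_ne_zero e (by omega)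
  refine ⟨?_, hlt, ?_⟩
  · exact (isOpen_interior.measure_pos volume (interior_coordPolytope_nonempty b hfg hSM)).trans_le
      (measure_mono interior_subset)
  have ht := tendsto_div_pow_of_convex hb ((convex_splittingPolytope M).linear_preimage _)
    (F := fun q ↦ (fractionalPoints S q ∩ splittingPolytope M S).ncard)
    (fun q hq ↦ ncard_interior_le b hfg hSM hpointed hsemi hq)
    (fun q hq ↦ ncard_le_closure b hfg hSM hpointed hq)
    (tendsto_pow_atTop_atTop_of_one_lt hp) hq
  rw [Fintype.card_fin] at ht
  have ht' := ENNReal.tendsto_ofReal ht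
  rw [ofReal_measureReal hlt.ne] at ht'
  refine ht'.congr fun e ↦ ?_
  rw [h, ← (finite_fractionalPoints_inter hfg hSM hpointed (hq e)).cast_ncard_eq,
    ENNReal.ofReal_div_of_pos (by have := hq e; positivity), ENNReal.ofReal_natCast,
    ENNReal.ofReal_pow (by positivity), ENNReal.ofReal_natCast, pow_mul]
  simp

end Volume

/-! ### Passing between split elements s and split points s/q, and the main theorem -/

section SplitPointsAndElements

theorem isSplitPoint_iff_isSplitElement {V : Type*} [AddCommGroup V] {M : Submodule ℤ V}
    {S : AddSubmonoid V} {q : ℕ} {u : V} :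
    IsSplitPoint M S q u ↔ q • u ∈ S ∧ IsSplitElement M S q (q • u) := by
  simp only [IsSplitPoint, IsSplitElement, smul_add]

variable {V : Type*} [NormedAddCommGroup V] [NormedSpace ℝ V] {M : Submodule ℤ V}
  {S : AddSubmonoid V}

theorem eq_zero_of_mem_of_neg_mem (hpointed : (monoidCone S : ConvexCone ℝ V).Salient) {m : V}
    (hm : m ∈ S) (hm' : -m ∈ S) : m = 0 := by
  by_contra h
  exact hpointed m (subset_monoidCone hm) h (subset_monoidCone hm')

theorem isSplitElement_iff_inv_smul {q : ℕ} (hq : q ≠ 0) (s : S) :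
    IsSplitElement M S q s ↔ IsSplitPoint M S q ((q : ℝ)⁻¹ • (s : V)) := by
  have hq' : (q : ℝ) ≠ 0 := by exact_mod_cast hq
  rw [isSplitPoint_iff_isSplitElement, ← Nat.cast_smul_eq_nsmul ℝ, smul_inv_smul₀ hq']
  exact ⟨fun h ↦ ⟨s.2, h⟩, fun h ↦ h.2⟩

theorem image_setOf_isSplitElement {q : ℕ} (hq : q ≠ 0) :
    (fun s : S ↦ (q : ℝ)⁻¹ • (s : V)) '' {s : S | IsSplitElement M S q s} =
      {u | IsSplitPoint M S q u} := by
  have hq' : (q : ℝ) ≠ 0 := by exact_mod_cast hq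
  ext u
  constructor
  · rintro ⟨s, hs, rfl⟩
    exact (isSplitElement_iff_inv_smul hq s).1 hs
  · intro hu
    have hu' := isSplitPoint_iff_isSplitElement.1 hu
    refine ⟨⟨_, hu'.1⟩, hu'.2, ?_⟩
    simp only
    rw [← Nat.cast_smul_eq_nsmul ℝ, inv_smul_smul₀ hq']

theorem injective_inv_smul {q : ℕ} (hq : q ≠ 0) :
    Function.Injective fun s : S ↦ (q : ℝ)⁻¹ • (s : V) :=
  (smul_right_injective V (inv_ne_zero (by exact_mod_cast hq))).comp Subtype.val_injective

end SplitPointsAndElements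

theorem theorem1p2
    {V : Type*} [NormedAddCommGroup V] [NormedSpace ℝ V] [FiniteDimensional ℝ V]
    (M : Submodule ℤ V) [DiscreteTopology M] [IsZLattice ℝ M]
    (S : AddSubmonoid V) (hfg : S.FG) (hSM : Submodule.span ℤ (S : Set V) = M)
    (hpointed : (monoidCone S : ConvexCone ℝ V).Salient)
    (hsemi : IsSeminormalMonoid S)
    (p : ℕ) [Fact p.Prime] (k : Type*) [Field k] [CharP k p] [PerfectField k]
    (hsplit : IsFSplit (AddMonoidAlgebra k S) p) :
    -- the splitting numbers
    (∀ e : ℕ, (fractionalPoints S (p ^ e) ∩ splittingPolytope M S).Finite ∧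
      fSplittingNumber (AddMonoidAlgebra k S) p e =
        (fractionalPoints S (p ^ e) ∩ splittingPolytope M S).encard) ∧
    -- the splitting dimension and the splitting ratio
    HasFSplittingDimRatio (AddMonoidAlgebra k S) p
      (finrank ℝ (Submodule.span ℝ (rufIntersection S : Set V)))
      (latticeVolume (faceLattice S (rufIntersection S)) (splittingPolytope M S)) ∧
    -- the splitting prime
    fSplittingPrime (AddMonoidAlgebra k S) p (monomialIdeal k {u : S | u ≠ 0}) =
      monomialIdeal k {u : S | (u : V) ∉ rufIntersection S} := by
  have hp : p.Prime := Fact.out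
  have hq (e : ℕ) : p ^ e ≠ 0 := pow_ne_zero e hp.ne_zero
  have hpS (e : ℕ) (x : V) (hx : x ∈ M) (h : p ^ e • x ∈ S) : x ∈ S :=
    mem_of_isFSplit hsplit e (by rwa [hSM]) h
  have hS (m : V) := eq_zero_of_mem_of_neg_mem (m := m) hpointed
  have hiff (e : ℕ) (u : V) := isSplitPoint_iff (e := e) (u := u) hfg hSM hsemi hp hpS
  have hfin (e : ℕ) := finite_fractionalPoints_inter hfg hSM hpointed (hq e)
  have himage (e : ℕ) : (fun s : S ↦ ((p ^ e : ℕ) : ℝ)⁻¹ • (s : V)) ''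
      {s : S | IsSplitElement (Submodule.span ℤ (S : Set V)) S (p ^ e) s} =
      fractionalPoints S (p ^ e) ∩ splittingPolytope M S := by
    rw [image_setOf_isSplitElement (hq e), hSM]
    exact Set.ext (hiff e)
  have hnum (e : ℕ) : fSplittingNumber (AddMonoidAlgebra k S) p e =
      (fractionalPoints S (p ^ e) ∩ splittingPolytope M S).encard := by
    rw [← himage, (injective_inv_smul (hq e)).encard_image]
    refine fSplittingNumber_eq_encard hS (Set.Finite.of_finite_image ?_
      (injective_inv_smul (hq e)).injOn)
    rw [himage]
    exact hfin e
  refine ⟨fun e ↦ ⟨hfin e, hnum e⟩,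
    hasFSplittingDimRatio_of_ncard hp.one_lt hfg hSM hpointed hsemi hnum, ?_⟩
  refine fSplittingPrime_eq_monomialIdeal hS ?_ ?_ ?_
  · intro t ht d hdt
    -- The complement of a face is stable under adding elements of `S`, so these monomials span an
    -- ideal.
    exact ht (rufIntersection_isFaceOf.mem_of_add_mem_right (subset_monoidCone d.2)
      (subset_monoidCone t.2) hdt)
  · intro s hs e hse
    rw [hSM, isSplitElement_iff_inv_smul (hq e)] at hse
    have := ((hiff e _).1 hse).2.2
    refine hs (((rufIntersection S).smul_mem_iff (inv_pos.2 ?_)).1 this)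
    have := hp.pos
    positivity
  · intro s hs
    have hev := eventually_smul_mem_splittingPolytope (M := M) hfg hSM (not_not.1 hs)
    -- For `s` in D_S, the points s/p^e eventually enter P_S, so `s` is split for some e > 0.
    have htend : Tendsto (fun e : ℕ ↦ ((p ^ e : ℕ) : ℝ)⁻¹) atTop (𝓝[>] 0) :=
      tendsto_inv_atTop_nhdsGT_zero.comp (tendsto_natCast_atTop_atTop.comp
        (tendsto_pow_atTop_atTop_of_one_lt hp.one_lt))
    obtain ⟨e, he, he0⟩ := ((htend.eventually hev).and (eventually_gt_atTop 0)).exists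
    refine ⟨e, he0, ?_⟩
    rw [hSM, isSplitElement_iff_inv_smul (hq e)]
    refine (hiff e _).2 ⟨?_, he⟩
    change p ^ e • _ ∈ S
    rw [← Nat.cast_smul_eq_nsmul ℝ, smul_inv_smul₀ (by exact_mod_cast hq e)]
    exact s.2
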